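/- **Model.** Fix $\lambda,r,\theta>0$, $\alpha>2$, $\eta\in(0,1]$ and an integer $A\ge 0$; put $\delta=2/\alpha$ and $\Omega_\delta=\pi\delta/\sin(\pi\delta)$. A typical receiver sits at the origin of the plane, at distance $r$ from its tagged source (node $0$). Interfering sources $X_1,X_2,\dots$ form a homogeneous Poisson point process of intensity $\lambda$. Slots are $t=0,1,2,\dots$. All fading variables $H_i(t)$ are i.i.d. exponential with mean $1$. At signal-to-noise ratio $\rho\in(0,\infty]$, $$\mathrm{SINR}(t)=\frac{H_0(t)\,r^{-\alpha}}{\sum_{j\ge1}H_j(t)\,\nu_j(t)\,\|X_j\|^{-\alpha}+1/\rho},$$ and for $\rho=\infty$ (no noise) this is the SIR. Here $\nu_i(t)\in\{0,1\}$ indicates whether node $i$ transmits in slot $t$. Threshold slotted ALOHA: if the age of information $\Delta_i(t)$ of node $i$ exceeds $A$, the node transmits a fresh sample with probability $\eta$, otherwise it is silent; after a successful transmission $\Delta_i(t+1)=1$, and in all other cases $\Delta_i(t+1)=\Delta_i(t)+1$. **Mean-field approximation (standing assumption).** Node $i$ has a service rate $\mu_i\in[0,1]$. Given the service rates, transmissions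 of node $i$ succeed with probability $\mu_i$, independently over nodes and slots. All coins and fading variables are independent of each other, of the topology and of the ages in slot $0$. The pairs $(\mu_j,\Delta_j(0))$, $j\ge1$, are independent of each other and of $(X_j)_{j\ge1}$, and the ages of the interferers are in steady state: the law of $(\mu_j,\Delta_j(t))$ does not depend on $t$. With $\Phi=(X_j,\mu_j)_{j\ge1}$, the service rate of the tagged link is $\mu_0=\mathbb P(\mathrm{SINR}(0)>\theta\mid\Phi)$, and each $\mu_j$, $j\ge 1$, has the same distribution $F$ as $\mu_0$. Write $P_s(\theta)=\mathbb E[\mathbb P(\mathrm{SINR}(t)>\theta\mid\Phi)]$, $a_0=\limsup_{T\to\infty}\frac1T\sum_{t<T}\nu_0(t)$ and $\varphi=\mathbb E[a_0]$. **Corollary (transmission success probability).** (1) *No noise.* If $\rho=\infty$, then almost surely $\frac1T\sum_{t<T}\nu_0(t)\to a_0$, one has $$\varphi=\int_0^1\frac{\eta}{1+A\eta u}\,dF(u),$$ and for every slot $t$ $$P_s(\theta)=\exp\bigl(-\lambda\pi r^2\theta^\delta\varphi\,\Omega_\delta\bigr).$$ Moreover $P_s(\theta)\approx\exp\bigl(-\frac{\lambda\pi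 r^2\theta^\delta\eta\,\Omega_\delta}{1+A\eta P_s(\theta)}\bigr)$, as an upper bound whose error is controlled by the variance of $\mu_0$: $$0\le\exp\Bigl(-\frac{\lambda\pi r^2\theta^\delta\eta\,\Omega_\delta}{1+A\eta P_s(\theta)}\Bigr)-P_s(\theta)\le\frac{\lambda\pi r^2\theta^\delta\,\Omega_\delta\,A^2\eta^3\,\mathrm{Var}(\mu_0)}{(1+A\eta P_s(\theta))^2}.$$ (2) *Vanishing noise.* For $\rho$ close to $\infty$ the same almost sure convergence and the same formula for $\varphi$ (with $F$ and $\varphi$ now depending on $\rho$) hold, and $P_s(\theta)-\exp(-\lambda\pi r^2\theta^\delta\varphi\,\Omega_\delta)\to0$ as $1/\rho\to0$, uniformly over all slots and all such networks on a given probability space with the given parameters. -/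

import Mathlib

open MeasureTheory ProbabilityTheory Filter Topology
open scoped ENNReal NNReal

noncomputable section

/-- `X 0, X 1, …` enumerates the points of a homogeneous Poisson point process in the plane with
intensity `lam`: the numbers of points in Borel sets of finite area are Poisson distributed with
mean `lam * area`, and the numbers of points in disjoint Borel sets are independent. -/
structure IsPlanarPPP {Ω : Type*} [MeasurableSpace Ω] (P : Measure Ω) (lam : ℝ)
    (X : ℕ → Ω → EuclideanSpace ℝ (Fin 2)) : Prop where
  measurable_pt : ∀ j, Measurable (X j)
  count_law : ∀ B : Set (EuclideanSpace ℝ (Fin 2)), MeasurableSet B → volume B < ⊤ →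
    HasLaw (fun ω => {j | X j ω ∈ B}.encard)
      ((poissonMeasure (lam.toNNReal * (volume B).toNNReal)).map (fun n : ℕ => (n : ℕ∞))) P
  count_indep : ∀ (n : ℕ) (B : Fin n → Set (EuclideanSpace ℝ (Fin 2))),
    (∀ i, MeasurableSet (B i)) → Pairwise (fun i k => Disjoint (B i) (B k)) →
    iIndepFun (fun i ω => {j | X j ω ∈ B i}.encard) P

/-- Deterministic parameters: spatial density `lam`, link distance `r`, path loss exponent `α`,
decoding threshold `θ`, update probability `η`, age threshold `A` (a number of slots). -/
structure TSAParams where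
  lam : ℝ
  r : ℝ
  α : ℝ
  θ : ℝ
  η : ℝ
  A : ℕ

namespace TSAParams

/-- `δ = 2 / α`. -/
def δ (p : TSAParams) : ℝ := 2 / p.α

/-- `Ω_δ = π δ / sin (π δ)`. -/
def Omega (p : TSAParams) : ℝ := Real.pi * p.δ / Real.sin (Real.pi * p.δ)

/-- `λ π r² θ^δ Ω_δ`. -/
def load (p : TSAParams) : ℝ := p.lam * Real.pi * p.r ^ 2 * p.θ ^ p.δ * p.Omega

end TSAParams

/-- The random primitives of the network as seen from the typical receiver, which sits at the
origin at distance `r` from its tagged source. The node `none` is the tagged source, the nodes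
`some 0, some 1, …` are the interfering sources. -/
structure TSANetwork (Ω : Type*) where
  /-- position of the `j`-th interfering source -/
  pos : ℕ → Ω → EuclideanSpace ℝ (Fin 2)
  /-- service rate (conditional transmission success probability) of the `j`-th interferer -/
  rate : ℕ → Ω → ℝ
  /-- age of information of a link in slot `0` -/
  initAge : Option ℕ → Ω → ℕ
  /-- fading from a source to the typical receiver in a slot -/
  fading : Option ℕ → ℕ → Ω → ℝ
  /-- outcome of the coin that a source flips in a slot to decide on updating -/
  access : Option ℕ → ℕ → Ω → Bool
  /-- uniform variable that decides whether a transmission of a node in a slot is decoded -/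
  decode : Option ℕ → ℕ → Ω → ℝ

/-- Labels of the independent sources of randomness: the environment (topology, service rates and
initial ages), and the fading, access and decoding variables of each node and slot. -/
inductive TSASeed : Type
  | env : TSASeed
  | fading (i : Option ℕ) (t : ℕ) : TSASeed
  | access (i : Option ℕ) (t : ℕ) : TSASeed
  | decode (i : Option ℕ) (t : ℕ) : TSASeed

namespace TSANetwork

variable {Ω : Type*} (N : TSANetwork Ω) (p : TSAParams)

/-- The age of information of node `i` at slot `t` when its transmissions succeed with conditional
probability `u`. A node is silent unless its age exceeds the threshold `A`; then it transmits a
fresh sample when its access coin says so. A successful transmission resets the age to one. -/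
def age (i : Option ℕ) (u : Ω → ℝ) : ℕ → Ω → ℕ
  | 0, ω => N.initAge i ω
  | t + 1, ω =>
      if p.A < age i u t ω ∧ N.access i t ω = true ∧ N.decode i t ω < u ω then 1
      else age i u t ω + 1

/-- The updating decision `ν_i(t) ∈ {0, 1}` of node `i` in slot `t`. -/
def active (i : Option ℕ) (u : Ω → ℝ) (t : ℕ) (ω : Ω) : ℝ :=
  if p.A < N.age p i u t ω ∧ N.access i t ω = true then 1 else 0

/-- Total interference at the typical receiver in slot `t`. -/
def interference (t : ℕ) (ω : Ω) : ℝ≥0∞ :=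
  ∑' j, ENNReal.ofReal (N.fading (some j) t ω * N.active p (some j) (N.rate j) t ω *
    ‖N.pos j ω‖ ^ (-p.α))

/-- The SINR at the typical receiver in slot `t`, at signal-to-noise ratio `ρ`. The value `ρ = ⊤`
means that there is no noise; the SINR is then the SIR. -/
def sinr (ρ : ℝ≥0∞) (t : ℕ) (ω : Ω) : ℝ≥0∞ :=
  ENNReal.ofReal (N.fading none t ω * p.r ^ (-p.α)) / (N.interference p t ω + ρ⁻¹)

/-- The information on the network topology: positions and service rates of the interferers. -/
def topology : MeasurableSpace Ω :=
  MeasurableSpace.comap (fun ω j => N.pos j ω) inferInstance ⊔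
    MeasurableSpace.comap (fun ω j => N.rate j ω) inferInstance

/-- The topology together with the initial ages of all nodes. -/
def environment : MeasurableSpace Ω :=
  N.topology ⊔ MeasurableSpace.comap (fun ω i => N.initAge i ω) inferInstance

/-- The σ-algebra generated by a source of randomness. -/
def seedAlgebra : TSASeed → MeasurableSpace Ω
  | .env => N.environment
  | .fading i t => MeasurableSpace.comap (N.fading i t) inferInstance
  | .access i t => MeasurableSpace.comap (N.access i t) inferInstance
  | .decode i t => MeasurableSpace.comap (N.decode i t) inferInstance

/-- The σ-algebras of the parts of the environment of the typical link: the positions of the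
interferers, and for each interferer its service rate and initial age. -/
def envAlgebra : Option ℕ → MeasurableSpace Ω
  | none => MeasurableSpace.comap (fun ω j => N.pos j ω) inferInstance
  | some j => MeasurableSpace.comap (fun ω => (N.rate j ω, N.initAge (some j) ω)) inferInstance

variable [MeasurableSpace Ω] (P : Measure Ω)

/-- `P(SINR_0(t) > θ | Φ)`: conditional transmission success probability of the typical link. -/
def condSuccess (ρ : ℝ≥0∞) (t : ℕ) : Ω → ℝ :=
  P⟦{ω | ENNReal.ofReal p.θ < N.sinr p ρ t ω} | N.topology⟧

/-- The service rate `μ_0` of the typical link. -/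
def serviceRate (ρ : ℝ≥0∞) : Ω → ℝ := N.condSuccess p P ρ 0

/-- The distribution `F` of the service rate. -/
def rateLaw (ρ : ℝ≥0∞) : Measure ℝ := P.map (N.serviceRate p P ρ)

/-- The transmission success probability `E[P(SINR_0(t) > θ | Φ)]`. -/
def successProb (ρ : ℝ≥0∞) (t : ℕ) : ℝ := ∫ ω, N.condSuccess p P ρ t ω ∂P

/-- Fraction of the first `T` slots in which the tagged source is active. -/
def activeAverage (ρ : ℝ≥0∞) (T : ℕ) (ω : Ω) : ℝ :=
  (∑ t ∈ Finset.range T, N.active p none (N.serviceRate p P ρ) t ω) / T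

/-- Long-run fraction of slots in which the tagged source is active. -/
def activeFraction (ρ : ℝ≥0∞) (ω : Ω) : ℝ :=
  limsup (fun T => N.activeAverage p P ρ T ω) atTop

/-- The unconditioned active probability `φ = E[a_0]` of the typical source. -/
def activeProb (ρ : ℝ≥0∞) : ℝ := ∫ ω, N.activeFraction p P ρ ω ∂P

/-- The stochastic model: a Poisson field of interferers with Rayleigh fading, running the
age-threshold ALOHA protocol in the steady state, under the mean-field approximation (the service
rates of the interferers are i.i.d. copies of that of the typical link, independent of the
positions, and given the service rates the links decode independently over nodes and slots). -/
structure IsMeanField (ρ : ℝ≥0∞) : Prop where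
  ppp : IsPlanarPPP P p.lam N.pos
  measurable_rate : ∀ j, Measurable (N.rate j)
  measurable_initAge : ∀ i, Measurable (N.initAge i)
  /-- Rayleigh fading -/
  fading_law : ∀ i t, HasLaw (N.fading i t) (expMeasure 1) P
  measurable_fading : ∀ i t, Measurable (N.fading i t)
  measurable_access : ∀ i t, Measurable (N.access i t)
  access_law : ∀ i t, P {ω | N.access i t ω = true} = ENNReal.ofReal p.η
  measurable_decode : ∀ i t, Measurable (N.decode i t)
  decode_law : ∀ i t, HasLaw (N.decode i t) (volume.restrict (Set.Icc (0 : ℝ) 1)) P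
  indep_seeds : iIndep N.seedAlgebra P
  indep_env : iIndep N.envAlgebra P
  /-- the service rates of all links have the same distribution -/
  rate_law : ∀ j, P.map (N.rate j) = N.rateLaw p P ρ
  /-- the ages of the interferers are in the steady state -/
  steady : ∀ j t, P.map (fun ω => (N.rate j ω, N.age p (some j) (N.rate j) t ω)) =
    P.map (fun ω => (N.rate j ω, N.initAge (some j) ω))

end TSANetwork

end

/-! The tagged fading is exponential and independent of the interference `I`, so a slot succeeds
with probability `E exp(-s (I + 1/ρ))`, where `s = θ r^α`. The noise contributes the factor
`exp(-s/ρ)`; what remains is the Laplace transform of `I` at `s` (`measure_success`).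

In a fixed slot, `I` is a sum over Poisson points carrying marks (fading, activity) that are
independent over nodes and of the positions. Averaging over an exponential fading and a 0/1 activity
`ν` at path loss `c` gives `1 - E[ν] s c / (1 + s c)`, so only the mean activity matters. The marked
Laplace functional (`lintegral_expNeg_tsum_marks`) and the integral of `s / (‖x‖^α + s)`, which is
`π s^δ Ω_δ` by Gamma reflection, then give `exp(-load * E[ν])` (`lintegral_expNeg_interference`).

It remains to show `E[ν] = φ`. Pathwise, every success is followed by `A` silent slots
(`card_silent_add_eq`). The centred access coins and the centred decodings are bounded and
orthogonal over time, so their averages vanish almost surely (`ae_tendsto_average_of_orthogonal`).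
Hence the active fraction `a` of a node with rate `u` satisfies `a = η (1 - A u a)`, that is `a = η
/ (1 + A η u)`. For an interferer, steadiness makes `E[ν]` constant in time, so it equals the limit
of its Cesàro means, and the common law of the rates identifies this limit with `φ`
(`integral_active`). The stationary age law is never computed.

Without noise, the mean of `μ_0` is the success probability itself. Expanding the convex map `u ↦ η
/ (1 + A η u)` to second order at this mean gives Jensen's bound and its variance error. With noise,
the success probability differs from the noiseless expression only by the factor `exp(-s/ρ)`, which
involves neither slot nor network; hence the uniformity. -/

/-! ### The exponential on `[0, ∞]` and the Poisson generating function. -/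

/-- The decreasing exponential `x ↦ exp (-x)` on `[0, ∞]`. -/
noncomputable def expNeg (x : ℝ≥0∞) : ℝ≥0∞ := (EReal.exp (x : EReal))⁻¹

theorem expNeg_zero : expNeg 0 = 1 := by simp [expNeg]

theorem expNeg_top : expNeg ⊤ = 0 := by simp [expNeg]

theorem expNeg_ofReal {x : ℝ} (hx : 0 ≤ x) :
    expNeg (ENNReal.ofReal x) = ENNReal.ofReal (Real.exp (-x)) := by
  rw [expNeg, EReal.coe_ennreal_ofReal, max_eq_left hx, EReal.exp_coe, Real.exp_neg,
    ENNReal.ofReal_inv_of_pos (Real.exp_pos x)]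

theorem continuous_expNeg : Continuous expNeg :=
  continuous_inv.comp (ENNReal.continuous_exp.comp continuous_coe_ennreal_ereal)

theorem measurable_expNeg : Measurable expNeg := continuous_expNeg.measurable

theorem antitone_expNeg : Antitone expNeg := fun x y h => by
  rw [expNeg, expNeg, ENNReal.inv_le_inv]
  exact EReal.exp_monotone (EReal.coe_ennreal_le_coe_ennreal_iff.2 h)

theorem expNeg_le_one (x : ℝ≥0∞) : expNeg x ≤ 1 :=
  expNeg_zero ▸ antitone_expNeg (zero_le)

theorem expNeg_add (x y : ℝ≥0∞) : expNeg (x + y) = expNeg x * expNeg y := by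
  have h (z : ℝ≥0∞) : EReal.exp (z : EReal) ≠ 0 := by
    rw [Ne, EReal.exp_eq_zero_iff]
    exact EReal.coe_ennreal_ne_bot z
  rw [expNeg, EReal.coe_ennreal_add, EReal.exp_add,
    ENNReal.mul_inv (Or.inl (h x)) (Or.inr (h y))]
  rfl

theorem expNeg_sum {ι : Type*} (s : Finset ι) (f : ι → ℝ≥0∞) :
    expNeg (∑ i ∈ s, f i) = ∏ i ∈ s, expNeg (f i) := by
  classical
  induction s using Finset.induction_on with
  | empty => simp [expNeg_zero]
  | insert a s ha ih => rw [Finset.sum_insert ha, Finset.prod_insert ha, expNeg_add, ih]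

theorem expNeg_nsmul (n : ℕ) (x : ℝ≥0∞) : expNeg (n * x) = expNeg x ^ n := by
  have := expNeg_sum (Finset.range n) (fun _ => x)
  simpa using this

/-- The power `z ^ n` merges with the Poisson weight `m ^ n / n!`, leaving the exponential series at
`m z`. -/
theorem lintegral_poissonMeasure_pow (m : ℝ≥0) (z : ℝ≥0) :
    ∫⁻ n, (z : ℝ≥0∞) ^ n ∂(poissonMeasure m) = ENNReal.ofReal (Real.exp (-(m * (1 - z)))) := by
  have hs : HasSum (fun n : ℕ => Real.exp (-m) * (((m : ℝ) * z) ^ n / n.factorial))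
      (Real.exp (-m) * Real.exp (m * z)) := by
    refine HasSum.mul_left _ ?_
    rw [Real.exp_eq_exp_ℝ]
    exact NormedSpace.expSeries_div_hasSum_exp (m * z : ℝ)
  rw [poissonMeasure, lintegral_sum_measure]
  simp_rw [lintegral_smul_measure, lintegral_dirac]
  have h1 : ∀ n : ℕ, ENNReal.ofReal (Real.exp (-m) * m ^ n / n.factorial) • (z : ℝ≥0∞) ^ n =
      ENNReal.ofReal (Real.exp (-m) * (((m : ℝ) * z) ^ n / n.factorial)) := fun n => by
    have : (z : ℝ≥0∞) ^ n = ENNReal.ofReal ((z : ℝ) ^ n) := by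
      rw [ENNReal.ofReal_pow z.coe_nonneg, ENNReal.ofReal_coe_nnreal]
    rw [this, smul_eq_mul, ← ENNReal.ofReal_mul (by positivity)]
    congr 1
    ring
  simp_rw [h1]
  rw [← ENNReal.ofReal_tsum_of_nonneg (fun n => by positivity) hs.summable, hs.tsum_eq,
    ← Real.exp_add]
  congr 2
  ring

/-- This is the generating function at `z = exp(-c)`. The case `c = ⊤` is included: then `z = 0`,
and `0 * ⊤ = 0` agrees with `0 ^ 0 = 1`. -/
theorem lintegral_poissonMeasure_expNeg (m : ℝ≥0) (c : ℝ≥0∞) :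
    ∫⁻ n : ℕ, expNeg (n * c) ∂(poissonMeasure m) = expNeg (m * (1 - expNeg c)) := by
  have hne : expNeg c ≠ ⊤ := ((expNeg_le_one c).trans_lt ENNReal.one_lt_top).ne
  simp_rw [expNeg_nsmul]
  obtain ⟨z, hz⟩ : ∃ z : ℝ≥0, (z : ℝ≥0∞) = expNeg c := ⟨_, ENNReal.coe_toNNReal hne⟩
  have hz1 : z ≤ 1 := by
    have := expNeg_le_one c
    rw [← hz] at this
    exact_mod_cast this
  rw [← hz, lintegral_poissonMeasure_pow m z, ← expNeg_ofReal]
  · congr 1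
    rw [ENNReal.ofReal_mul m.coe_nonneg, ENNReal.ofReal_coe_nnreal, ENNReal.ofReal_sub _ z.coe_nonneg,
      ENNReal.ofReal_coe_nnreal, ENNReal.ofReal_one]
  · have : (z : ℝ) ≤ 1 := hz1
    exact mul_nonneg m.coe_nonneg (by linarith)

/-! ### The Laplace functional of a planar Poisson process. -/

theorem tsum_indicator_one_comp {ι β : Type*} (x : ι → β) (B : Set β) :
    ∑' j, B.indicator (fun _ => (1 : ℝ≥0∞)) (x j) = ({j | x j ∈ B}.encard : ℝ≥0∞) := by
  rw [← ENNReal.tsum_set_one, tsum_subtype {j | x j ∈ B} (fun _ => (1 : ℝ≥0∞))]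
  rfl

namespace IsPlanarPPP

variable {Ω : Type*} [MeasurableSpace Ω] {P : Measure Ω} {lam : ℝ}
  {X : ℕ → Ω → EuclideanSpace ℝ (Fin 2)}

theorem lintegral_expNeg_count (hX : IsPlanarPPP P lam X)
    {B : Set (EuclideanSpace ℝ (Fin 2))} (hB : MeasurableSet B) (hB' : volume B < ⊤)
    (c : ℝ≥0∞) :
    ∫⁻ ω, expNeg ((({j | X j ω ∈ B}.encard : ℕ∞) : ℝ≥0∞) * c) ∂P =
      expNeg (ENNReal.ofReal lam * volume B * (1 - expNeg c)) := by
  have hm : Measurable (fun n : ℕ∞ => expNeg ((n : ℝ≥0∞) * c)) := .of_discrete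
  rw [(hX.count_law B hB hB').lintegral_comp (f := fun n : ℕ∞ => expNeg ((n : ℝ≥0∞) * c))
    hm.aemeasurable, lintegral_map hm .of_discrete]
  simp only [ENat.toENNReal_coe]
  rw [lintegral_poissonMeasure_expNeg, ENNReal.coe_mul, ENNReal.coe_toNNReal hB'.ne]
  rfl

/-- The sum over the points is a finite combination of counts in the disjoint level sets, so
independence turns the expectation into a product and the exponents add up. The value 0 contributes
nothing and is dropped; its level set may have infinite area, where `count_law` says nothing. -/
theorem lintegral_expNeg_tsum_simpleFunc [IsProbabilityMeasure P] (hX : IsPlanarPPP P lam X)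
    (f : SimpleFunc (EuclideanSpace ℝ (Fin 2)) ℝ≥0∞)
    (hf : ∀ c, c ≠ 0 → volume (f ⁻¹' {c}) < ⊤) :
    ∫⁻ ω, expNeg (∑' j, f (X j ω)) ∂P =
      expNeg (ENNReal.ofReal lam * ∫⁻ x, 1 - expNeg (f x)) := by
  classical
  set S := f.range.filter (· ≠ 0) with hS
  set e := S.equivFin
  set B : Fin S.card → Set (EuclideanSpace ℝ (Fin 2)) := fun i => f ⁻¹' {(e.symm i : ℝ≥0∞)}
    with hBdef
  have hB : ∀ i, MeasurableSet (B i) := fun i => f.measurableSet_fiber _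
  have hfin : ∀ i, volume (B i) < ⊤ := fun i =>
    hf _ (Finset.mem_filter.1 (e.symm i).2).2
  have hsum : ∀ (F : ℝ≥0∞ → ℝ≥0∞), ∑ c ∈ S, F c = ∑ i, F (e.symm i) := fun F => by
    rw [← Finset.sum_coe_sort S]
    exact (Equiv.sum_comp e.symm (fun c : S => F c)).symm
  have hdec : ∀ x, f x = ∑ i, (B i).indicator (fun _ => (1 : ℝ≥0∞)) x * (e.symm i : ℝ≥0∞) := by
    intro x
    rw [← hsum (fun c => (f ⁻¹' {c}).indicator (fun _ => (1 : ℝ≥0∞)) x * c)]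
    by_cases h0 : f x = 0
    · rw [h0]
      refine (Finset.sum_eq_zero fun c hc => ?_).symm
      have : c ≠ 0 := (Finset.mem_filter.1 hc).2
      rw [Set.indicator_of_notMem, zero_mul]
      simp [h0, this.symm]
    · rw [Finset.sum_eq_single (f x)]
      · simp
      · intro c _ hc
        rw [Set.indicator_of_notMem, zero_mul]
        simpa using hc.symm
      · intro h
        exact absurd (Finset.mem_filter.2 ⟨f.mem_range_self x, h0⟩) h
  have hcount : ∀ ω, ∑' j, f (X j ω) =
      ∑ i, ((({j | X j ω ∈ B i}.encard : ℕ∞) : ℝ≥0∞) * (e.symm i : ℝ≥0∞)) := by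
    intro ω
    simp_rw [hdec (X _ ω)]
    rw [Summable.tsum_finsetSum (fun _ _ => ENNReal.summable)]
    refine Finset.sum_congr rfl fun i _ => ?_
    rw [ENNReal.tsum_mul_right, tsum_indicator_one_comp]
  have hind : iIndepFun (fun i ω => {j | X j ω ∈ B i}.encard) P := by
    refine hX.count_indep _ B hB fun i k hik => ?_
    refine Disjoint.preimage _ ?_
    rw [Set.disjoint_singleton]
    intro h
    exact hik (e.symm.injective (Subtype.ext h))
  have hind' := hind.comp (fun i (n : ℕ∞) => expNeg ((n : ℝ≥0∞) * (e.symm i : ℝ≥0∞)))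
    (fun i => .of_discrete)
  have hmeas : ∀ i, Measurable (fun ω => {j | X j ω ∈ B i}.encard) := by
    intro i
    have h1 : Measurable fun ω => {j | X j ω ∈ B i} :=
      measurable_set_iff.2 fun j => (hX.measurable_pt j (hB i)).mem
    exact measurable_encard.comp h1
  simp_rw [hcount, expNeg_sum]
  have := lintegral_prod_eq_prod_lintegral_of_indepFun Finset.univ _ hind'
    (fun i => (Measurable.of_discrete (f := fun n : ℕ∞ =>
      expNeg ((n : ℝ≥0∞) * (e.symm i : ℝ≥0∞)))).comp (hmeas i))
  simp only [Function.comp_def] at this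
  rw [this]
  simp_rw [fun i => hX.lintegral_expNeg_count (hB i) (hfin i) (e.symm i : ℝ≥0∞)]
  rw [← expNeg_sum]
  congr 1
  have hint : ∫⁻ x, 1 - expNeg (f x) = ∑ c ∈ S, (1 - expNeg c) * volume (f ⁻¹' {c}) := by
    have h := SimpleFunc.map_lintegral (fun c => 1 - expNeg c) f (μ := volume)
    rw [← SimpleFunc.lintegral_eq_lintegral, SimpleFunc.coe_map] at h
    simp only [Function.comp_def] at h
    rw [h, hS, Finset.sum_filter]
    refine Finset.sum_congr rfl fun c _ => ?_
    by_cases hc : c = 0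
    · simp [hc, expNeg_zero]
    · rw [if_pos hc]
  rw [hint, hsum (fun c => (1 - expNeg c) * volume (f ⁻¹' {c})), Finset.mul_sum]
  refine Finset.sum_congr rfl fun i _ => ?_
  rw [mul_assoc, mul_comm (volume (B i))]

/-- The Laplace functional of a planar Poisson point process. -/
theorem lintegral_expNeg_tsum [IsProbabilityMeasure P] (hX : IsPlanarPPP P lam X)
    {h : EuclideanSpace ℝ (Fin 2) → ℝ≥0∞} (hh : Measurable h) :
    ∫⁻ ω, expNeg (∑' j, h (X j ω)) ∂P =
      expNeg (ENNReal.ofReal lam * ∫⁻ x, 1 - expNeg (h x)) := by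
  -- Cutting off outside growing balls gives the nonzero level sets finite area and keeps the
  -- approximation increasing to `h`.
  set f : ℕ → SimpleFunc (EuclideanSpace ℝ (Fin 2)) ℝ≥0∞ := fun n =>
    (SimpleFunc.eapprox h n).restrict (Metric.ball 0 n) with hf
  have hball : ∀ n : ℕ, MeasurableSet (Metric.ball (0 : EuclideanSpace ℝ (Fin 2)) n) :=
    fun n => measurableSet_ball
  have hval : ∀ n x, f n x =
      (Metric.ball (0 : EuclideanSpace ℝ (Fin 2)) n).indicator (SimpleFunc.eapprox h n) x :=
    fun n x => by rw [hf]; simp only [SimpleFunc.restrict_apply _ (hball n)]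
  have hfin : ∀ n c, c ≠ 0 → volume (f n ⁻¹' {c}) < ⊤ := by
    intro n c hc
    refine (measure_mono (t := Metric.ball 0 n) ?_).trans_lt measure_ball_lt_top
    intro x hx
    by_contra hn
    have h2 : f n x = c := hx
    rw [hval, Set.indicator_of_notMem hn] at h2
    exact hc h2.symm
  have hmono : ∀ x, Monotone fun n => f n x := by
    intro x n m hnm
    simp only [hval]
    refine (Set.indicator_le_indicator (SimpleFunc.monotone_eapprox h hnm x)).trans ?_
    refine Set.indicator_le_indicator_of_subset (Metric.ball_subset_ball (by exact_mod_cast hnm))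
      (fun _ => zero_le) x
  have hlim : ∀ x, Tendsto (fun n => f n x) atTop (𝓝 (h x)) := by
    intro x
    refine (SimpleFunc.tendsto_eapprox hh x).congr' ?_
    obtain ⟨k, hk⟩ := exists_nat_gt ‖x‖
    filter_upwards [eventually_ge_atTop k] with n hn
    rw [hval, Set.indicator_of_mem]
    rw [mem_ball_zero_iff]
    exact hk.trans_le (by exact_mod_cast hn)
  have hsup : ∀ x, ⨆ n, f n x = h x := fun x =>
    tendsto_nhds_unique (tendsto_atTop_iSup (hmono x)) (hlim x)
  have hmf : ∀ n, Measurable (f n) := fun n => (f n).measurable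
  have hL : Tendsto (fun n => ∫⁻ ω, expNeg (∑' j, f n (X j ω)) ∂P) atTop
      (𝓝 (∫⁻ ω, expNeg (∑' j, h (X j ω)) ∂P)) := by
    refine tendsto_lintegral_of_dominated_convergence (fun _ => 1) ?_ ?_ (by simp) ?_
    · intro n
      exact measurable_expNeg.comp (Measurable.tsum fun j =>
        (hmf n).comp (hX.measurable_pt j))
    · exact fun n => Eventually.of_forall fun ω => expNeg_le_one _
    · refine Eventually.of_forall fun ω => (continuous_expNeg.tendsto _).comp ?_
      have h1 : ∑' j, h (X j ω) = ⨆ n, ∑' j, f n (X j ω) := by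
        simp_rw [← hsup]
        simp_rw [← lintegral_count]
        exact lintegral_iSup (fun n => .of_discrete) (fun n m hnm j => hmono _ hnm)
      rw [h1]
      exact tendsto_atTop_iSup fun n m hnm => ENNReal.tsum_le_tsum fun j => hmono _ hnm
  have hR : Tendsto (fun n => ∫⁻ x, 1 - expNeg (f n x)) atTop
      (𝓝 (∫⁻ x, 1 - expNeg (h x))) := by
    refine lintegral_tendsto_of_tendsto_of_monotone ?_ ?_ ?_
    · exact fun n => (measurable_const.sub (measurable_expNeg.comp (hmf n))).aemeasurable
    · exact Eventually.of_forall fun x n m hnm =>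
        tsub_le_tsub_left (antitone_expNeg (hmono x hnm)) 1
    · refine Eventually.of_forall fun x => ?_
      exact ENNReal.Tendsto.sub tendsto_const_nhds
        ((continuous_expNeg.tendsto _).comp (hlim x)) (Or.inl ENNReal.one_ne_top)
  have hR' := (continuous_expNeg.tendsto _).comp
    (ENNReal.Tendsto.const_mul hR (Or.inr (ENNReal.ofReal_ne_top (r := lam))))
  refine tendsto_nhds_unique hL (hR'.congr fun n => ?_)
  exact (hX.lintegral_expNeg_tsum_simpleFunc (f n) (hfin n)).symm

end IsPlanarPPP

/-! ### Path loss integrals over the plane. -/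

/-- In polar coordinates this is a Gamma integral with radial weight `2 π y`. -/
theorem lintegral_exp_neg_mul_norm_rpow {α v : ℝ} (hα : 0 < α) (hv : 0 < v) :
    ∫⁻ x : EuclideanSpace ℝ (Fin 2), ENNReal.ofReal (Real.exp (-v * ‖x‖ ^ α)) =
      ENNReal.ofReal (2 * Real.pi * (v ^ (-(2 / α)) * (1 / α) * Real.Gamma (2 / α))) := by
  have hIoi : IntegrableOn (fun y : ℝ => y ^ (1 : ℝ) * Real.exp (-v * y ^ α)) (Set.Ioi 0) :=
    integrableOn_rpow_mul_exp_neg_mul_rpow (by norm_num) hα hv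
  have hint : Integrable
      (fun x : EuclideanSpace ℝ (Fin 2) => (fun y : ℝ => Real.exp (-v * y ^ α)) ‖x‖) := by
    rw [integrable_fun_norm_addHaar volume (f := fun y : ℝ => Real.exp (-v * y ^ α))]
    simpa using hIoi
  have hball : (volume : Measure (EuclideanSpace ℝ (Fin 2))).real (Metric.ball 0 1) =
      Real.pi := by
    simp [Measure.real, EuclideanSpace.volume_ball_fin_two, Real.pi_pos.le]
  have h := integral_fun_norm_addHaar (volume : Measure (EuclideanSpace ℝ (Fin 2)))
    (fun y : ℝ => Real.exp (-v * y ^ α))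
  have h2 := integral_rpow_mul_exp_neg_mul_rpow hα (q := 1) (by norm_num) hv
  simp only [Real.rpow_one] at h2
  simp only [finrank_euclideanSpace, Fintype.card_fin, hball, smul_eq_mul, pow_one,
    Nat.add_one_sub_one, nsmul_eq_mul] at h
  rw [h2] at h
  rw [← ofReal_integral_eq_lintegral_ofReal hint (Eventually.of_forall fun x => by positivity), h]
  congr 1
  rw [show -(1 + 1) / α = -(2 / α) by ring, show (1 + 1) / α = 2 / α by ring]
  push_cast
  ring

theorem lintegral_exp_neg_mul_Ioi {c : ℝ} (hc : 0 < c) :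
    ∫⁻ v in Set.Ioi (0 : ℝ), ENNReal.ofReal (Real.exp (-c * v)) = ENNReal.ofReal (1 / c) := by
  rw [← ofReal_integral_eq_lintegral_ofReal (integrableOn_exp_mul_Ioi (by linarith) 0)
    (Eventually.of_forall fun x => by positivity), integral_exp_mul_Ioi (by linarith)]
  congr 1
  simp

theorem lintegral_rpow_mul_exp_neg_mul_Ioi {a c : ℝ} (ha : 0 < a) (hc : 0 < c) :
    ∫⁻ v in Set.Ioi (0 : ℝ), ENNReal.ofReal (v ^ (a - 1) * Real.exp (-(c * v))) =
      ENNReal.ofReal ((1 / c) ^ a * Real.Gamma a) := by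
  have h := Real.integral_rpow_mul_exp_neg_mul_Ioi ha hc
  rw [← h, ofReal_integral_eq_lintegral_ofReal]
  · by_contra hn
    rw [integral_undef hn] at h
    exact absurd h (by have := Real.Gamma_pos_of_pos ha; positivity)
  · filter_upwards [ae_restrict_mem measurableSet_Ioi] with v hv
    have : 0 < v := hv
    positivity

/-- The spatial integral of the path loss function of Rayleigh fading interferers. -/
theorem lintegral_div_norm_rpow_add {α s : ℝ} (hα : 2 < α) (hs : 0 < s) :
    ∫⁻ x : EuclideanSpace ℝ (Fin 2), ENNReal.ofReal (s / (‖x‖ ^ α + s)) =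
      ENNReal.ofReal (Real.pi * s ^ (2 / α) *
        (Real.pi * (2 / α) / Real.sin (Real.pi * (2 / α)))) := by
  have hα0 : 0 < α := by linarith
  have hδ : 0 < 2 / α := by positivity
  have hδ1 : 2 / α < 1 := by rw [div_lt_one hα0]; exact hα
  set δ := 2 / α
  have hmeas : Measurable (fun z : EuclideanSpace ℝ (Fin 2) × ℝ =>
      ENNReal.ofReal s * (ENNReal.ofReal (Real.exp (-s * z.2)) *
        ENNReal.ofReal (Real.exp (-z.2 * ‖z.1‖ ^ α)))) := by fun_prop
  -- Writing `1 / (‖x‖^α + s)` as `∫ exp(-(‖x‖^α + s) v) dv` separates `x` from `s`. By Tonelli the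
  -- integral over `x` comes first and yields a multiple of `v ^ (-δ)`; the integral over `v` is
  -- then a Gamma integral at `1 - δ`, finite because `δ < 1`.
  have h1 : ∀ x : EuclideanSpace ℝ (Fin 2), ENNReal.ofReal (s / (‖x‖ ^ α + s)) =
      ∫⁻ v in Set.Ioi (0 : ℝ), ENNReal.ofReal s * (ENNReal.ofReal (Real.exp (-s * v)) *
        ENNReal.ofReal (Real.exp (-v * ‖x‖ ^ α))) := by
    intro x
    have hc : 0 < ‖x‖ ^ α + s := by positivity
    rw [lintegral_const_mul _ (by fun_prop)]
    have : ∀ v : ℝ, ENNReal.ofReal (Real.exp (-s * v)) *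
        ENNReal.ofReal (Real.exp (-v * ‖x‖ ^ α)) =
        ENNReal.ofReal (Real.exp (-(‖x‖ ^ α + s) * v)) := fun v => by
      rw [← ENNReal.ofReal_mul (by positivity), ← Real.exp_add]
      congr 2
      ring
    simp_rw [this]
    rw [lintegral_exp_neg_mul_Ioi hc, ← ENNReal.ofReal_mul hs.le]
    congr 1
    ring
  simp_rw [h1]
  rw [lintegral_lintegral_swap hmeas.aemeasurable]
  have h2 : ∀ v ∈ Set.Ioi (0 : ℝ), ∫⁻ x : EuclideanSpace ℝ (Fin 2),
      ENNReal.ofReal s * (ENNReal.ofReal (Real.exp (-s * v)) *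
        ENNReal.ofReal (Real.exp (-v * ‖x‖ ^ α))) =
      ENNReal.ofReal (s * Real.pi * δ * Real.Gamma δ) *
        ENNReal.ofReal (v ^ ((1 - δ) - 1) * Real.exp (-(s * v))) := by
    intro v hv
    have hv0 : 0 < v := hv
    have hG := Real.Gamma_pos_of_pos hδ
    rw [lintegral_const_mul _ (by fun_prop), lintegral_const_mul _ (by fun_prop),
      lintegral_exp_neg_mul_norm_rpow hα0 hv0, ← ENNReal.ofReal_mul (by positivity),
      ← ENNReal.ofReal_mul hs.le, ← ENNReal.ofReal_mul (by positivity)]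
    congr 1
    rw [show 1 - δ - 1 = -δ by ring, show -(s * v) = -s * v by ring]
    simp only [show δ = 2 / α from rfl]
    ring
  have hG := Real.Gamma_pos_of_pos hδ
  rw [setLIntegral_congr_fun measurableSet_Ioi h2, lintegral_const_mul _ (by fun_prop),
    lintegral_rpow_mul_exp_neg_mul_Ioi (by linarith) hs, ← ENNReal.ofReal_mul (by positivity)]
  congr 1
  have hR := Real.Gamma_mul_Gamma_one_sub δ
  have hss : s * (1 / s) ^ (1 - δ) = s ^ δ := by
    rw [one_div, Real.inv_rpow hs.le, ← Real.rpow_neg hs.le]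
    nth_rewrite 1 [← Real.rpow_one s]
    rw [← Real.rpow_add hs]
    congr 1
    ring
  calc s * Real.pi * δ * Real.Gamma δ * ((1 / s) ^ (1 - δ) * Real.Gamma (1 - δ))
      = Real.pi * (s * (1 / s) ^ (1 - δ)) * δ * (Real.Gamma δ * Real.Gamma (1 - δ)) := by ring
    _ = _ := by rw [hss, hR]; ring

/-! ### A strong law from orthogonality. -/

/-- For `n = ⌊√T⌋` one has `n² ≤ T ≤ n² + 2n`, so `S` moves by at most `2n` between `n²` and `T`,
which is negligible against `n²`. -/
theorem tendsto_div_nat_of_tendsto_sq {S : ℕ → ℝ} (hS : ∀ n, |S (n + 1) - S n| ≤ 1)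
    (h : Tendsto (fun n : ℕ => S (n ^ 2) / (n : ℝ) ^ 2) atTop (𝓝 0)) :
    Tendsto (fun T : ℕ => S T / T) atTop (𝓝 0) := by
  have hinc : ∀ n k, |S (n + k) - S n| ≤ k := by
    intro n k
    induction k with
    | zero => simp
    | succ k ih =>
      have h1 := hS (n + k)
      have h2 : S (n + (k + 1)) - S n = (S (n + k + 1) - S (n + k)) + (S (n + k) - S n) := by
        rw [← add_assoc]; ring
      rw [h2]
      push_cast
      exact (abs_add_le _ _).trans (by linarith)
  have hsqrt : Tendsto Nat.sqrt atTop atTop := by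
    refine tendsto_atTop.2 fun b => ?_
    filter_upwards [eventually_ge_atTop (b * b)] with n hn
    exact Nat.le_sqrt.2 hn
  have h0 : Tendsto (fun n : ℕ => |S (n ^ 2) / (n : ℝ) ^ 2| + 2 / (n : ℝ)) atTop (𝓝 0) := by
    have := h.abs.add (tendsto_const_div_atTop_nhds_zero_nat (2 : ℝ))
    simpa using this
  refine squeeze_zero_norm' ?_ (h0.comp hsqrt)
  filter_upwards [eventually_ge_atTop 1] with T hT
  set n := Nat.sqrt T with hn
  have hn1 : 1 ≤ n := Nat.le_sqrt.2 (by simpa using hT)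
  have hle : n ^ 2 ≤ T := by rw [pow_two]; exact Nat.sqrt_le T
  have hle2 : T ≤ n ^ 2 + 2 * n := by
    have := Nat.sqrt_le_add T
    rw [pow_two, hn]; omega
  obtain ⟨k, hk⟩ := Nat.exists_eq_add_of_le hle
  have hk2 : (k : ℝ) ≤ 2 * n := by
    have : k ≤ 2 * n := by omega
    exact_mod_cast this
  have hnR : (1 : ℝ) ≤ n := by exact_mod_cast hn1
  have hTR : (n : ℝ) ^ 2 ≤ T := by exact_mod_cast hle
  have hST : |S T| ≤ |S (n ^ 2)| + 2 * n := by
    have h3 := hinc (n ^ 2) k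
    rw [← hk] at h3
    have h4 := abs_sub_abs_le_abs_sub (S T) (S (n ^ 2))
    linarith
  simp only [Function.comp_apply, Real.norm_eq_abs, ← hn]
  rw [abs_div, abs_div, abs_of_nonneg (show (0 : ℝ) ≤ (T : ℝ) by positivity),
    abs_of_nonneg (show (0 : ℝ) ≤ (n : ℝ) ^ 2 by positivity)]
  have h5 : |S (n ^ 2)| / (n : ℝ) ^ 2 + 2 / (n : ℝ) = (|S (n ^ 2)| + 2 * n) / (n : ℝ) ^ 2 := by
    field_simp
  rw [h5]
  exact div_le_div₀ (by positivity) hST (by positivity) hTR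

/-- The strong law of large numbers for bounded orthogonal random variables. -/
theorem ae_tendsto_average_of_orthogonal {Ω : Type*} [MeasurableSpace Ω] {P : Measure Ω}
    [IsProbabilityMeasure P] {D : ℕ → Ω → ℝ} (hD : ∀ n, Measurable (D n))
    (hb : ∀ n, ∀ᵐ ω ∂P, |D n ω| ≤ 1) (ho : ∀ s t, s < t → ∫ ω, D s ω * D t ω ∂P = 0) :
    ∀ᵐ ω ∂P, Tendsto (fun T : ℕ => (∑ t ∈ Finset.range T, D t ω) / T) atTop (𝓝 0) := by
  have hb' : ∀ᵐ ω ∂P, ∀ n, |D n ω| ≤ 1 := ae_all_iff.2 hb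
  set S : ℕ → Ω → ℝ := fun T ω => ∑ t ∈ Finset.range T, D t ω with hSdef
  have hSm : ∀ T, Measurable (S T) := fun T =>
    Finset.measurable_fun_sum (Finset.range T) fun t _ => hD t
  have hint : ∀ s t, Integrable (fun ω => D s ω * D t ω) P := fun s t => by
    refine Integrable.of_bound ((hD s).mul (hD t)).aestronglyMeasurable 1 ?_
    filter_upwards [hb s, hb t] with ω h1 h2
    rw [Real.norm_eq_abs, abs_mul]
    exact mul_le_one₀ h1 (abs_nonneg _) h2
  have hSD : ∀ T, (fun ω => S T ω * D T ω) = fun ω => ∑ t ∈ Finset.range T, D t ω * D T ω :=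
    fun T => by ext ω; simp [hSdef, Finset.sum_mul]
  have hSDi : ∀ T, Integrable (fun ω => S T ω * D T ω) P := fun T => by
    rw [hSD]
    exact integrable_finsetSum _ fun t _ => hint t T
  have hSD0 : ∀ T, ∫ ω, S T ω * D T ω ∂P = 0 := fun T => by
    rw [hSD, integral_finsetSum _ fun t _ => hint t T]
    exact Finset.sum_eq_zero fun t ht => ho t T (Finset.mem_range.1 ht)
  have hexp : ∀ T ω, S (T + 1) ω ^ 2 = S T ω ^ 2 + 2 * (S T ω * D T ω) + D T ω * D T ω := by
    intro T ω
    simp only [hSdef, Finset.sum_range_succ]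
    ring
  -- Orthogonality removes the cross terms. Along squares the second moment of `S / n²` is then at
  -- most `1 / n²`, which is summable; hence the series of squares is almost surely finite and its
  -- terms vanish.
  have hsq : ∀ T, Integrable (fun ω => S T ω ^ 2) P ∧ ∫ ω, S T ω ^ 2 ∂P ≤ T := by
    intro T
    induction T with
    | zero => simp [hSdef]
    | succ T ih =>
      simp_rw [hexp]
      have i1 : Integrable (fun ω => S T ω ^ 2 + 2 * (S T ω * D T ω)) P :=
        ih.1.add ((hSDi T).const_mul 2)
      refine ⟨i1.add (hint T T), ?_⟩
      rw [integral_add i1 (hint T T), integral_add ih.1 ((hSDi T).const_mul 2),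
        integral_const_mul, hSD0]
      have h1 : ∫ ω, D T ω * D T ω ∂P ≤ ∫ _, (1 : ℝ) ∂P := by
        refine integral_mono_ae (hint T T) (integrable_const _) ?_
        filter_upwards [hb T] with ω h
        exact (abs_le_one_iff_mul_self_le_one).1 h
      simp only [integral_const, probReal_univ, smul_eq_mul, mul_one] at h1
      push_cast
      linarith [ih.2]
  have hterm : ∀ n : ℕ, ∫⁻ ω, ENNReal.ofReal ((S (n ^ 2) ω / (n : ℝ) ^ 2) ^ 2) ∂P ≤
      ENNReal.ofReal (1 / (n : ℝ) ^ 2) := by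
    intro n
    have i1 : Integrable (fun ω => (S (n ^ 2) ω / (n : ℝ) ^ 2) ^ 2) P := by
      simp_rw [div_pow]
      exact (hsq (n ^ 2)).1.div_const _
    rw [← ofReal_integral_eq_lintegral_ofReal i1 (Eventually.of_forall fun ω => by positivity)]
    refine ENNReal.ofReal_le_ofReal ?_
    simp_rw [div_pow]
    rw [integral_div]
    rcases Nat.eq_zero_or_pos n with rfl | hn
    · simp
    · have hn' : (0 : ℝ) < n := by exact_mod_cast hn
      rw [div_le_div_iff₀ (by positivity) (by positivity)]
      have := (hsq (n ^ 2)).2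
      push_cast at this
      nlinarith [pow_pos hn' 2]
  have hfin : ∫⁻ ω, ∑' n : ℕ, ENNReal.ofReal ((S (n ^ 2) ω / (n : ℝ) ^ 2) ^ 2) ∂P ≠ ⊤ := by
    rw [lintegral_tsum fun n => (((hSm _).div_const _).pow_const 2).ennreal_ofReal.aemeasurable]
    refine ne_top_of_le_ne_top ?_ (ENNReal.tsum_le_tsum hterm)
    have hs : Summable fun n : ℕ => 1 / (n : ℝ) ^ 2 := Real.summable_one_div_nat_pow.2 one_lt_two
    rw [← ENNReal.ofReal_tsum_of_nonneg (fun n => by positivity) hs]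
    exact ENNReal.ofReal_ne_top
  have hae := ae_lt_top (Measurable.tsum fun n : ℕ =>
    (((hSm (n ^ 2)).div_const ((n : ℝ) ^ 2)).pow_const 2).ennreal_ofReal) hfin
  filter_upwards [hae, hb'] with ω hω hbω
  refine tendsto_div_nat_of_tendsto_sq (S := fun T => S T ω) (fun n => ?_) ?_
  · simp only [hSdef, Finset.sum_range_succ, add_sub_cancel_left]
    exact hbω n
  · have h1 := ENNReal.tendsto_atTop_zero_of_tsum_ne_top hω.ne
    have h2 := (ENNReal.tendsto_toReal ENNReal.zero_ne_top).comp h1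
    have h3 : Tendsto (fun n : ℕ => (S (n ^ 2) ω / (n : ℝ) ^ 2) ^ 2) atTop (𝓝 0) := by
      refine h2.congr fun n => ?_
      simp only [Function.comp_apply]
      exact ENNReal.toReal_ofReal (by positivity)
    have h4 := h3.sqrt
    simp only [Real.sqrt_sq_eq_abs, Real.sqrt_zero] at h4
    exact (tendsto_zero_iff_abs_tendsto_zero _).2 h4

/-! ### The pathwise renewal argument. -/

/-- The silent slots of an age process that is reset to one by a success and whose successes need
an age above `A`: up to boundary terms, each success is followed by `A` silent slots. -/
theorem card_silent_add_eq {A : ℕ} {age : ℕ → ℕ} {R : ℕ → Prop} [DecidablePred R]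
    (hage : ∀ t, age (t + 1) = if R t then 1 else age t + 1) (hR : ∀ t, R t → A < age t) (T : ℕ) :
    (∑ t ∈ Finset.range T, if A < age t then 0 else 1) + (A + 1 - age T) =
      A * (∑ t ∈ Finset.range T, if R t then 1 else 0) + (A + 1 - age 0) := by
  -- The truncated difference `A + 1 - age` counts the silent slots still owed: it is 0 for an
  -- eligible node, drops by one in each silent slot, and jumps to `A` after a success, since the
  -- age restarts at 1.
  induction T with
  | zero => simp
  | succ T ih =>
    rw [Finset.sum_range_succ, Finset.sum_range_succ, mul_add, hage]
    by_cases h : R T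
    · have := hR T h
      simp only [h, this, if_true]
      omega
    · by_cases h' : A < age T <;> simp only [h, h', if_true, if_false] <;> omega

/-- The renewal argument for the fraction of active slots: `a t`, `R t` and `A < age t` say that
the node is active, is successful and is allowed to transmit in slot `t`. -/
theorem tendsto_active_average {A : ℕ} {age : ℕ → ℕ} {R a : ℕ → Prop} [DecidablePred R]
    [DecidablePred a] (hage : ∀ t, age (t + 1) = if R t then 1 else age t + 1)
    (hR : ∀ t, R t → A < age t) {η u : ℝ} (hη : 0 ≤ η) (hu : 0 ≤ u)
    (h1 : Tendsto (fun T : ℕ => (∑ t ∈ Finset.range T,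
      ((if a t then (1 : ℝ) else 0) - η * if A < age t then 1 else 0)) / T) atTop (𝓝 0))
    (h2 : Tendsto (fun T : ℕ => (∑ t ∈ Finset.range T,
      ((if R t then (1 : ℝ) else 0) - u * if a t then 1 else 0)) / T) atTop (𝓝 0)) :
    Tendsto (fun T : ℕ => (∑ t ∈ Finset.range T, if a t then (1 : ℝ) else 0) / T) atTop
      (𝓝 (η / (1 + A * η * u))) := by
  have hpos : (0 : ℝ) < 1 + A * η * u := by positivity
  have h3 : Tendsto (fun T : ℕ => (((A + 1 - age 0 : ℕ) : ℝ) - ((A + 1 - age T : ℕ) : ℝ)) / T)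
      atTop (𝓝 0) := by
    refine squeeze_zero_norm (fun T => ?_)
      (tendsto_const_div_atTop_nhds_zero_nat ((A : ℝ) + 1))
    rw [Real.norm_eq_abs, abs_div, Nat.abs_cast]
    refine div_le_div_of_nonneg_right ?_ (Nat.cast_nonneg T)
    have e1 : ((A + 1 - age 0 : ℕ) : ℝ) ≤ (A : ℝ) + 1 := by exact_mod_cast Nat.sub_le _ _
    have e2 : ((A + 1 - age T : ℕ) : ℝ) ≤ (A : ℝ) + 1 := by exact_mod_cast Nat.sub_le _ _
    have e3 : (0 : ℝ) ≤ ((A + 1 - age 0 : ℕ) : ℝ) := Nat.cast_nonneg _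
    have e4 : (0 : ℝ) ≤ ((A + 1 - age T : ℕ) : ℝ) := Nat.cast_nonneg _
    exact abs_le.2 ⟨by linarith, by linarith⟩
  -- By the counting identity, the eligible and the success counts cancel in this combination; `1 +
  -- A η u` times the active average is left.
  have h4 := (h1.sub ((h2.const_mul (η * A)).add (h3.const_mul η))).add_const η
  have h5 := h4.div_const (1 + A * η * u)
  simp only [mul_zero, add_zero, sub_zero, zero_add] at h5
  refine h5.congr' ?_
  filter_upwards [eventually_gt_atTop 0] with T hT
  have hT' : (T : ℝ) ≠ 0 := by exact_mod_cast hT.ne'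
  have hc := card_silent_add_eq hage hR T
  have hsil : ((∑ t ∈ Finset.range T, if A < age t then 0 else 1 : ℕ) : ℝ) =
      T - ∑ t ∈ Finset.range T, if A < age t then (1 : ℝ) else 0 := by
    push_cast
    have : ∀ t, (if A < age t then (0 : ℝ) else 1) = 1 - if A < age t then (1 : ℝ) else 0 :=
      fun t => by split_ifs <;> simp
    simp only [this, Finset.sum_sub_distrib, Finset.sum_const, Finset.card_range, nsmul_eq_mul,
      mul_one]
  have hc' : (T - ∑ t ∈ Finset.range T, if A < age t then (1 : ℝ) else 0) +
      ((A + 1 - age T : ℕ) : ℝ) = A * (∑ t ∈ Finset.range T, if R t then (1 : ℝ) else 0) +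
      ((A + 1 - age 0 : ℕ) : ℝ) := by
    rw [← hsil]
    have := congrArg (Nat.cast : ℕ → ℝ) hc
    push_cast at this ⊢
    exact this
  simp only [Finset.sum_sub_distrib, ← Finset.mul_sum]
  generalize (∑ t ∈ Finset.range T, if A < age t then (1 : ℝ) else 0) = G at *
  generalize (∑ t ∈ Finset.range T, if R t then (1 : ℝ) else 0) = r at *
  generalize (∑ t ∈ Finset.range T, if a t then (1 : ℝ) else 0) = x at *
  generalize ((A + 1 - age T : ℕ) : ℝ) = y at *
  generalize ((A + 1 - age 0 : ℕ) : ℝ) = z at *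
  have : z - y = T - G - A * r := by linarith
  rw [this]
  field_simp
  ring

/-! ### Adapted randomness and the long-run activity of a node. -/

/-- Fubini: with the past `W` frozen, the fresh variable `d` averages to zero. No integrability is
required, since the Bochner integral of a non-integrable function is 0. -/
theorem integral_comp_eq_zero_of_indepFun {Ω β γ : Type*} [MeasurableSpace Ω] [MeasurableSpace β]
    [MeasurableSpace γ] {P : Measure Ω} [IsProbabilityMeasure P] {W : Ω → β} {d : Ω → γ}
    (hW : Measurable W) (hd : Measurable d) (hind : IndepFun W d P) {f : β × γ → ℝ}
    (hf : Measurable f) (h0 : ∀ᵐ ω ∂P, ∫ y, f (W ω, y) ∂(P.map d) = 0) :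
    ∫ ω, f (W ω, d ω) ∂P = 0 := by
  by_cases hi : Integrable (fun ω => f (W ω, d ω)) P
  · have := Measure.isProbabilityMeasure_map (μ := P) hd.aemeasurable
    have := Measure.isProbabilityMeasure_map (μ := P) hW.aemeasurable
    have hlaw := (indepFun_iff_map_prod_eq_prod_map_map hW.aemeasurable hd.aemeasurable).1 hind
    have hi' : Integrable f ((P.map W).prod (P.map d)) := by
      rw [← hlaw]
      exact (integrable_map_measure hf.aestronglyMeasurable
        (hW.prodMk hd).aemeasurable).2 hi
    have e1 : ∫ ω, f (W ω, d ω) ∂P = ∫ z, f z ∂((P.map W).prod (P.map d)) := by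
      rw [← hlaw, integral_map (hW.prodMk hd).aemeasurable hf.aestronglyMeasurable]
    rw [e1, integral_prod _ hi']
    rw [integral_map hW.aemeasurable
      hf.stronglyMeasurable.integral_prod_right'.aestronglyMeasurable]
    exact integral_eq_zero_of_ae h0
  · exact integral_undef hi

namespace TSANetwork

variable {Ω : Type*} (N : TSANetwork Ω) (p : TSAParams)

/-- Node `i` transmits successfully in slot `t`. -/
def Success (i : Option ℕ) (u : Ω → ℝ) (t : ℕ) (ω : Ω) : Prop :=
  p.A < N.age p i u t ω ∧ N.access i t ω = true ∧ N.decode i t ω < u ω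

theorem active_nonneg (i : Option ℕ) (u : Ω → ℝ) (t : ℕ) (ω : Ω) : 0 ≤ N.active p i u t ω := by
  unfold active; split_ifs <;> norm_num

theorem active_le_one (i : Option ℕ) (u : Ω → ℝ) (t : ℕ) (ω : Ω) : N.active p i u t ω ≤ 1 := by
  unfold active; split_ifs <;> norm_num

section Measurability

variable [MeasurableSpace Ω] {i : Option ℕ} {u : Ω → ℝ} {t : ℕ}

/-- The σ-algebra on `Ω` is arbitrary and only variables before slot `t` enter, so the lemma also
serves for the σ-algebra of the past and for that of a single node. -/
theorem measurable_age (h0 : Measurable (N.initAge i)) (hu : Measurable u)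
    (ha : ∀ s < t, Measurable (N.access i s)) (hd : ∀ s < t, Measurable (N.decode i s)) :
    Measurable (N.age p i u t) := by
  induction t with
  | zero => exact h0
  | succ t ih =>
    have ih' := ih (fun s hs => ha s (by omega)) (fun s hs => hd s (by omega))
    refine Measurable.ite ?_ measurable_const (ih'.add_const 1)
    exact (measurableSet_lt measurable_const ih').inter
      ((measurableSet_eq_fun (ha t (by omega)) measurable_const).inter
        (measurableSet_lt (hd t (by omega)) hu))

theorem measurable_active (hage : Measurable (N.age p i u t)) (ha : Measurable (N.access i t)) :
    Measurable (N.active p i u t) :=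
  Measurable.ite ((measurableSet_lt measurable_const hage).inter
    (measurableSet_eq_fun ha measurable_const)) measurable_const measurable_const

open Classical in
theorem measurable_success (hage : Measurable (N.age p i u t)) (hu : Measurable u)
    (ha : Measurable (N.access i t)) (hd : Measurable (N.decode i t)) :
    Measurable (fun ω => if N.Success p i u t ω then (1 : ℝ) else 0) :=
  Measurable.ite ((measurableSet_lt measurable_const hage).inter
    ((measurableSet_eq_fun ha measurable_const).inter (measurableSet_lt hd hu)))
    measurable_const measurable_const

theorem measurable_eligible (hage : Measurable (N.age p i u t)) :
    Measurable (fun ω => if p.A < N.age p i u t ω then (1 : ℝ) else 0) :=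
  Measurable.ite (measurableSet_lt measurable_const hage) measurable_const measurable_const

end Measurability

namespace IsMeanField

variable {N p} [MeasurableSpace Ω] {P : Measure Ω} {ρ : ℝ≥0∞}

theorem topology_le (h : N.IsMeanField p P ρ) : N.topology ≤ ‹MeasurableSpace Ω› :=
  sup_le (measurable_pi_lambda _ h.ppp.measurable_pt).comap_le
    (measurable_pi_lambda _ h.measurable_rate).comap_le

theorem environment_le (h : N.IsMeanField p P ρ) : N.environment ≤ ‹MeasurableSpace Ω› :=
  sup_le h.topology_le (measurable_pi_lambda _ h.measurable_initAge).comap_le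

theorem seedAlgebra_le (h : N.IsMeanField p P ρ) (k : TSASeed) :
    N.seedAlgebra k ≤ ‹MeasurableSpace Ω› := by
  cases k with
  | env => exact h.environment_le
  | fading i t => exact (h.measurable_fading i t).comap_le
  | access i t => exact (h.measurable_access i t).comap_le
  | decode i t => exact (h.measurable_decode i t).comap_le

end IsMeanField

theorem measurable_initAge_environment (i : Option ℕ) :
    Measurable[N.environment] (N.initAge i) := by
  have h : Measurable[MeasurableSpace.comap (fun ω i => N.initAge i ω) inferInstance]
      (fun ω i => N.initAge i ω) := comap_measurable _
  exact ((measurable_pi_apply i).comp h).mono le_sup_right le_rfl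

theorem measurable_rate_topology (j : ℕ) : Measurable[N.topology] (N.rate j) := by
  have h : Measurable[MeasurableSpace.comap (fun ω i => N.rate i ω) inferInstance]
      (fun ω i => N.rate i ω) := comap_measurable _
  exact ((measurable_pi_apply j).comp h).mono le_sup_right le_rfl

/-- The σ-algebra generated by a set of sources of randomness. -/
@[reducible] def seedSup (S : Set TSASeed) : MeasurableSpace Ω := ⨆ k ∈ S, N.seedAlgebra k

theorem seedAlgebra_le_seedSup {S : Set TSASeed} {k : TSASeed} (hk : k ∈ S) :
    N.seedAlgebra k ≤ N.seedSup S := le_iSup₂_of_le k hk le_rfl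

/-- The environment and the access and decoding variables of node `i` before slot `t`. -/
def past (i : Option ℕ) (t : ℕ) : Set TSASeed :=
  {k | k = .env ∨ ∃ s < t, k = .access i s ∨ k = .decode i s}

theorem past_mono (i : Option ℕ) {s t : ℕ} (h : s ≤ t) : past i s ⊆ past i t := by
  rintro k (hk | ⟨r, hr, hk⟩)
  · exact Or.inl hk
  · exact Or.inr ⟨r, hr.trans_le h, hk⟩

/-- Ages are adapted, which makes the coins of slot `t` independent of the age in slot `t`. -/
theorem measurable_age_seedSup {i : Option ℕ} {u : Ω → ℝ} (hu : Measurable[N.environment] u)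
    {t : ℕ} {S : Set TSASeed} (hS : past i t ⊆ S) :
    Measurable[N.seedSup S] (N.age p i u t) := by
  have he : N.environment ≤ N.seedSup S := N.seedAlgebra_le_seedSup (k := .env) (hS (Or.inl rfl))
  refine @measurable_age Ω N p (N.seedSup S) i u t
    ((N.measurable_initAge_environment i).mono he le_rfl) (hu.mono he le_rfl) ?_ ?_
  · intro s hs
    exact (comap_measurable (N.access i s)).mono
      (N.seedAlgebra_le_seedSup (k := .access i s) (hS (Or.inr ⟨s, hs, Or.inl rfl⟩))) le_rfl
  · intro s hs
    exact (comap_measurable (N.decode i s)).mono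
      (N.seedAlgebra_le_seedSup (k := .decode i s) (hS (Or.inr ⟨s, hs, Or.inr rfl⟩))) le_rfl

namespace IsMeanField

variable {N p} [MeasurableSpace Ω] {P : Measure Ω} {ρ : ℝ≥0∞}

theorem seedSup_le (h : N.IsMeanField p P ρ) (S : Set TSASeed) :
    N.seedSup S ≤ ‹MeasurableSpace Ω› := iSup₂_le fun k _ => h.seedAlgebra_le k

theorem indepFun_of_seedSup (h : N.IsMeanField p P ρ) {S : Set TSASeed} {k : TSASeed}
    (hk : k ∉ S) {β γ : Type*} [MeasurableSpace β] [MeasurableSpace γ] {f : Ω → β} {g : Ω → γ}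
    (hf : Measurable[N.seedSup S] f) (hg : Measurable[N.seedAlgebra k] g) : IndepFun f g P := by
  have hi := indep_iSup_of_disjoint h.seedAlgebra_le h.indep_seeds
    (Set.disjoint_singleton_right.2 hk)
  refine indep_of_indep_of_le_left (indep_of_indep_of_le_right hi ?_) hf.comap_le
  exact hg.comap_le.trans (N.seedAlgebra_le_seedSup (Set.mem_singleton k))

theorem measureReal_access (h : N.IsMeanField p P ρ) (hη : 0 ≤ p.η) (i : Option ℕ) (t : ℕ) :
    P.real {ω | N.access i t ω = true} = p.η := by
  rw [Measure.real, h.access_law, ENNReal.toReal_ofReal hη]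

theorem integral_access_sub [IsProbabilityMeasure P] (h : N.IsMeanField p P ρ) (hη : 0 ≤ p.η)
    (i : Option ℕ) (t : ℕ) (z : ℝ) :
    ∫ b, z * ((if b = true then (1 : ℝ) else 0) - p.η) ∂(P.map (N.access i t)) = 0 := by
  rw [integral_map (h.measurable_access i t).aemeasurable
    Measurable.of_discrete.aestronglyMeasurable, integral_const_mul]
  have hs : MeasurableSet {ω | N.access i t ω = true} :=
    measurableSet_eq_fun (h.measurable_access i t) measurable_const
  have e : (fun ω => if N.access i t ω = true then (1 : ℝ) else 0) =
      Set.indicator {ω | N.access i t ω = true} 1 := by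
    ext ω; simp [Set.indicator_apply]
  rw [integral_sub (by rw [e]; exact (integrable_const 1).indicator hs) (integrable_const _), e,
    integral_indicator_one hs, h.measureReal_access hη]
  simp

/-- A uniform variable falls below `v` with probability `v`, provided that `v` lies in `[0, 1]`.
Here `z` and `v` stand for frozen values from the past. -/
theorem integral_decode_sub (h : N.IsMeanField p P ρ) (i : Option ℕ) (t : ℕ) (z : ℝ) {v : ℝ}
    (hv : v ∈ Set.Icc (0 : ℝ) 1) :
    ∫ y, z * ((if y < v then (1 : ℝ) else 0) - v) ∂(P.map (N.decode i t)) = 0 := by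
  rw [(h.decode_law i t).map_eq, integral_const_mul]
  have e : (fun y => if y < v then (1 : ℝ) else 0) = Set.indicator (Set.Iio v) 1 := by
    ext ω; simp [Set.indicator_apply]
  have hvol : (volume.restrict (Set.Icc (0 : ℝ) 1)).real (Set.Iio v) = v := by
    rw [Measure.real, Measure.restrict_apply measurableSet_Iio]
    have : Set.Iio v ∩ Set.Icc 0 1 = Set.Ico 0 v := by
      ext y
      simp only [Set.mem_inter_iff, Set.mem_Iio, Set.mem_Icc, Set.mem_Ico]
      constructor
      · rintro ⟨a, b, c⟩; exact ⟨b, a⟩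
      · rintro ⟨a, b⟩; exact ⟨b, a, by linarith [hv.2]⟩
    rw [this, Real.volume_Ico, sub_zero, ENNReal.toReal_ofReal hv.1]
  rw [integral_sub (by rw [e]; exact (integrable_const 1).indicator measurableSet_Iio)
    (integrable_const _), e, integral_indicator_one measurableSet_Iio, hvol]
  simp

open Classical in
/-- Long-run fraction of active slots of a node with service rate `u`. -/
theorem ae_tendsto_active_average [IsProbabilityMeasure P] (h : N.IsMeanField p P ρ)
    (hη : 0 ≤ p.η) (hη' : p.η ≤ 1) (i : Option ℕ) {u : Ω → ℝ} (hu : Measurable[N.environment] u)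
    (hu01 : ∀ᵐ ω ∂P, u ω ∈ Set.Icc (0 : ℝ) 1) :
    ∀ᵐ ω ∂P, Tendsto (fun T : ℕ => (∑ t ∈ Finset.range T, N.active p i u t ω) / T) atTop
      (𝓝 (p.η / (1 + p.A * p.η * u ω))) := by
  have hum : Measurable u := hu.mono h.environment_le le_rfl
  have hagem : ∀ t, Measurable (N.age p i u t) := fun t =>
    N.measurable_age p (h.measurable_initAge i) hum (fun s _ => h.measurable_access i s)
      (fun s _ => h.measurable_decode i s)
  -- `D` and `E` are the two noises to be averaged out: activity minus `η` times eligibility, and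
  -- success minus `u` times activity. Each is a past-measurable factor times a centred fresh
  -- variable.
  set D : ℕ → Ω → ℝ := fun t ω =>
    N.active p i u t ω - p.η * if p.A < N.age p i u t ω then 1 else 0 with hD
  set E : ℕ → Ω → ℝ := fun t ω =>
    (if N.Success p i u t ω then (1 : ℝ) else 0) - u ω * N.active p i u t ω with hE
  have hDeq : ∀ t ω, D t ω = (if p.A < N.age p i u t ω then (1 : ℝ) else 0) *
      ((if N.access i t ω = true then (1 : ℝ) else 0) - p.η) := by
    intro t ω
    simp only [hD, active]
    by_cases h1 : p.A < N.age p i u t ω <;> by_cases h2 : N.access i t ω = true <;> simp [h1, h2]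
  have hEeq : ∀ t ω, E t ω = N.active p i u t ω *
      ((if N.decode i t ω < u ω then (1 : ℝ) else 0) - u ω) := by
    intro t ω
    simp only [hE, active, Success]
    by_cases h1 : p.A < N.age p i u t ω <;> by_cases h2 : N.access i t ω = true <;>
      by_cases h3 : N.decode i t ω < u ω <;> simp [h1, h2, h3]
  have hDconv : ∀ᵐ ω ∂P, Tendsto (fun T : ℕ => (∑ t ∈ Finset.range T, D t ω) / T) atTop
      (𝓝 0) := by
    refine ae_tendsto_average_of_orthogonal ?_ ?_ ?_
    · exact fun t => (N.measurable_active p (hagem t) (h.measurable_access i t)).sub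
        ((N.measurable_eligible p (hagem t)).const_mul _)
    · refine fun t => Eventually.of_forall fun ω => ?_
      rw [hDeq]
      split_ifs <;> rw [abs_le] <;> constructor <;> linarith
    · intro s t hst
      -- `Z` gathers all of `D s * D t` that is determined before the access coin of slot `t`.
      set Z : Ω → ℝ := fun ω => D s ω * if p.A < N.age p i u t ω then (1 : ℝ) else 0 with hZ
      have ha : Measurable[N.seedSup (past i t)] (N.access i s) :=
        (comap_measurable (N.access i s)).mono
          (N.seedAlgebra_le_seedSup (k := .access i s) (Or.inr ⟨s, hst, Or.inl rfl⟩)) le_rfl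
      have hages := N.measurable_age_seedSup p hu (past_mono i hst.le)
      have haget := N.measurable_age_seedSup p hu (subset_refl (past i t))
      have hZm : Measurable[N.seedSup (past i t)] Z := by
        refine Measurable.mul (Measurable.sub ?_ (Measurable.const_mul ?_ _)) ?_
        · exact @measurable_active Ω N p (N.seedSup (past i t)) i u s hages ha
        · exact @measurable_eligible Ω N p (N.seedSup (past i t)) i u s hages
        · exact @measurable_eligible Ω N p (N.seedSup (past i t)) i u t haget
      have hk : TSASeed.access i t ∉ past i t := by
        rintro (hk | ⟨r, hr, hk | hk⟩)
        · cases hk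
        · cases hk; exact lt_irrefl _ hr
        · cases hk
      have hind : IndepFun Z (N.access i t) P :=
        h.indepFun_of_seedSup hk hZm (comap_measurable _)
      have e : ∀ ω, D s ω * D t ω =
          (fun q : ℝ × Bool => q.1 * ((if q.2 = true then (1 : ℝ) else 0) - p.η))
            (Z ω, N.access i t ω) := by
        intro ω
        rw [hDeq t, hZ]
        simp only
        ring
      simp_rw [e]
      refine integral_comp_eq_zero_of_indepFun (hZm.mono (h.seedSup_le _) le_rfl)
        (h.measurable_access i t) hind
        (f := fun q : ℝ × Bool => q.1 * ((if q.2 = true then (1 : ℝ) else 0) - p.η)) ?_ ?_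
      · exact measurable_fst.mul (Measurable.sub_const
          ((Measurable.of_discrete (f := fun b : Bool => if b = true then (1 : ℝ) else 0)).comp
            measurable_snd) _)
      · exact Eventually.of_forall fun ω => h.integral_access_sub hη i t (Z ω)
  have hEconv : ∀ᵐ ω ∂P, Tendsto (fun T : ℕ => (∑ t ∈ Finset.range T, E t ω) / T) atTop
      (𝓝 0) := by
    refine ae_tendsto_average_of_orthogonal ?_ ?_ ?_
    · exact fun t => (N.measurable_success p (hagem t) hum (h.measurable_access i t)
        (h.measurable_decode i t)).sub
        (hum.mul (N.measurable_active p (hagem t) (h.measurable_access i t)))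
    · intro t
      filter_upwards [hu01] with ω hω
      rw [hEeq, abs_mul, abs_of_nonneg (N.active_nonneg p i u t ω)]
      refine mul_le_one₀ (N.active_le_one p i u t ω) (abs_nonneg _) ?_
      rw [abs_le]
      split_ifs <;> constructor <;> linarith [hω.1, hω.2]
    · intro s t hst
      -- Activity in slot `t` uses the access coin of that slot, so this coin joins the past; the
      -- decoding variable is the only fresh one.
      set S : Set TSASeed := past i t ∪ {.access i t} with hS
      set Z : Ω → ℝ := fun ω => E s ω * N.active p i u t ω with hZ
      have hsub : past i t ⊆ S := Set.subset_union_left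
      have huS : Measurable[N.seedSup S] u :=
        hu.mono (N.seedAlgebra_le_seedSup (k := .env) (Or.inl (Or.inl rfl))) le_rfl
      have ha : Measurable[N.seedSup S] (N.access i s) :=
        (comap_measurable (N.access i s)).mono
          (N.seedAlgebra_le_seedSup (k := .access i s) (Or.inl (Or.inr ⟨s, hst, Or.inl rfl⟩)))
          le_rfl
      have hd : Measurable[N.seedSup S] (N.decode i s) :=
        (comap_measurable (N.decode i s)).mono
          (N.seedAlgebra_le_seedSup (k := .decode i s) (Or.inl (Or.inr ⟨s, hst, Or.inr rfl⟩)))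
          le_rfl
      have hat : Measurable[N.seedSup S] (N.access i t) :=
        (comap_measurable (N.access i t)).mono
          (N.seedAlgebra_le_seedSup (k := .access i t) (Or.inr rfl)) le_rfl
      have hages := N.measurable_age_seedSup p hu ((past_mono i hst.le).trans hsub)
      have haget := N.measurable_age_seedSup p hu hsub
      have hZm : Measurable[N.seedSup S] Z := by
        refine Measurable.mul (Measurable.sub ?_ (Measurable.mul huS ?_)) ?_
        · exact @measurable_success Ω N p (N.seedSup S) i u s hages huS ha hd
        · exact @measurable_active Ω N p (N.seedSup S) i u s hages ha
        · exact @measurable_active Ω N p (N.seedSup S) i u t haget hat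
      -- The decoding threshold `u` is random, so it has to be frozen together with `Z`.
      have hW : Measurable[N.seedSup S] (fun ω => (Z ω, u ω)) := hZm.prodMk huS
      have hk : TSASeed.decode i t ∉ S := by
        rintro ((hk | ⟨r, hr, hk | hk⟩) | hk)
        · cases hk
        · cases hk
        · cases hk; exact lt_irrefl _ hr
        · cases hk
      have hind : IndepFun (fun ω => (Z ω, u ω)) (N.decode i t) P :=
        h.indepFun_of_seedSup hk hW (comap_measurable _)
      have e : ∀ ω, E s ω * E t ω =
          (fun q : (ℝ × ℝ) × ℝ => q.1.1 * ((if q.2 < q.1.2 then (1 : ℝ) else 0) - q.1.2))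
            ((fun ω => (Z ω, u ω)) ω, N.decode i t ω) := by
        intro ω
        rw [hEeq t, hZ]
        simp only
        ring
      simp_rw [e]
      refine integral_comp_eq_zero_of_indepFun (hW.mono (h.seedSup_le _) le_rfl)
        (h.measurable_decode i t) hind
        (f := fun q : (ℝ × ℝ) × ℝ => q.1.1 * ((if q.2 < q.1.2 then (1 : ℝ) else 0) - q.1.2)) ?_ ?_
      · refine measurable_fst.fst.mul (Measurable.sub ?_ measurable_fst.snd)
        exact Measurable.ite (measurableSet_lt measurable_snd measurable_fst.snd)
          measurable_const measurable_const
      · filter_upwards [hu01] with ω hω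
        exact h.integral_decode_sub i t (Z ω) hω
  filter_upwards [hDconv, hEconv, hu01] with ω h1 h2 hω
  refine tendsto_active_average (A := p.A) (age := fun t => N.age p i u t ω)
    (R := fun t => N.Success p i u t ω)
    (a := fun t => p.A < N.age p i u t ω ∧ N.access i t ω = true) ?_ ?_ hη hω.1 ?_ ?_
  · intro t
    simp only [age, Success]
    congr
  · exact fun t ht => ht.1
  · exact h1
  · exact h2

end IsMeanField

end TSANetwork

/-! ### Independent marks. -/

theorem lintegral_comp_of_indepFun {Ω β γ : Type*} [MeasurableSpace Ω] [MeasurableSpace β]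
    [MeasurableSpace γ] {P : Measure Ω} [IsProbabilityMeasure P] {W : Ω → β} {d : Ω → γ}
    (hW : Measurable W) (hd : Measurable d) (hind : IndepFun W d P) {f : β × γ → ℝ≥0∞}
    (hf : Measurable f) :
    ∫⁻ ω, f (W ω, d ω) ∂P = ∫⁻ ω, ∫⁻ ω', f (W ω, d ω') ∂P ∂P := by
  have := Measure.isProbabilityMeasure_map (μ := P) hd.aemeasurable
  have := Measure.isProbabilityMeasure_map (μ := P) hW.aemeasurable
  have hlaw := (indepFun_iff_map_prod_eq_prod_map_map hW.aemeasurable hd.aemeasurable).1 hind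
  rw [← lintegral_map hf (hW.prodMk hd), hlaw, lintegral_prod _ hf.aemeasurable,
    lintegral_map hf.lintegral_prod_right' hW]
  refine lintegral_congr fun ω => ?_
  exact lintegral_map (hf.comp measurable_prodMk_left) hd

/-- Independence is preserved when one of the independent σ-algebras is refined into independent
parts. -/
theorem ProbabilityTheory.iIndep.sumElim {Ω ι κ : Type*} [mΩ : MeasurableSpace Ω]
    {P : Measure Ω} {m : ι → MeasurableSpace Ω} {m' : κ → MeasurableSpace Ω} {k₀ : κ}
    (hm : iIndep m P) (hm' : iIndep m' P) (hle : ∀ i, m i ≤ m' k₀) :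
    iIndep (Sum.elim m (fun k : {k // k ≠ k₀} => m' k)) P := by
  classical
  rw [iIndep_iff]
  intro s f hs
  -- All events from the finer parts are merged into the single event `B` of `m' k₀`; the coarse
  -- independence splits off `B`, the fine one factors it.
  set B : Set Ω := ⋂ i ∈ s.toLeft, f (Sum.inl i) with hB
  have hfl : ∀ i ∈ s.toLeft, MeasurableSet[m i] (f (Sum.inl i)) := fun i hi =>
    hs _ (Finset.mem_toLeft.1 hi)
  have hPB : P B = ∏ i ∈ s.toLeft, P (f (Sum.inl i)) := hm.meas_biInter hfl
  have hBm : MeasurableSet[m' k₀] B :=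
    @Finset.measurableSet_biInter _ _ (m' k₀) _ _ fun i hi => hle i _ (hfl i hi)
  set g : κ → Set Ω := fun k => if h : k = k₀ then B else f (Sum.inr ⟨k, h⟩) with hg
  set t : Finset κ := s.toRight.map (Function.Embedding.subtype _) with ht
  have hk₀ : k₀ ∉ t := by simp [ht]
  have hg0 : g k₀ = B := by simp [hg]
  have hgr : ∀ k : {k // k ≠ k₀}, g k = f (Sum.inr k) := fun k => by simp [hg, k.2]
  have hgm : ∀ k ∈ insert k₀ t, MeasurableSet[m' k] (g k) := by
    intro k hk
    rcases Finset.mem_insert.1 hk with rfl | hk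
    · rw [hg0]; exact hBm
    · obtain ⟨k', hk', rfl⟩ := Finset.mem_map.1 hk
      have := hs _ (Finset.mem_toRight.1 hk')
      simp only [Function.Embedding.subtype_apply, hgr]
      exact this
  have h := hm'.meas_biInter hgm
  rw [Finset.prod_insert hk₀, hg0, hPB, ht, Finset.prod_map] at h
  simp only [Function.Embedding.subtype_apply, hgr] at h
  have hset : (⋂ i ∈ s, f i) = ⋂ i ∈ insert k₀ t, g i := by
    rw [Finset.set_biInter_insert, hg0, hB]
    ext ω
    simp only [Set.mem_iInter, Set.mem_inter_iff, Finset.mem_toLeft]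
    constructor
    · intro hω
      refine ⟨fun i hi => hω _ hi, fun k hk => ?_⟩
      obtain ⟨k', hk', rfl⟩ := Finset.mem_map.1 hk
      simp only [Function.Embedding.subtype_apply, hgr]
      exact hω _ (Finset.mem_toRight.1 hk')
    · rintro ⟨h1, h2⟩ (i | k) hi
      · exact h1 i hi
      · rw [← hgr]
        exact h2 k (Finset.mem_map.2 ⟨k, Finset.mem_toRight.2 hi, rfl⟩)
  have hprod : ∏ i ∈ s, P (f i) =
      (∏ i ∈ s.toLeft, P (f (Sum.inl i))) * ∏ k ∈ s.toRight, P (f (Sum.inr k)) := by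
    conv_lhs => rw [← Finset.toLeft_disjSum_toRight (u := s)]
    rw [Finset.prod_disjSum]
  rw [hset, h, hprod]

/-- Integrating out independent marks `Y 0, Y 1, …` of points `X 0, X 1, …`. -/
theorem lintegral_prod_marks {Ω E F : Type*} [MeasurableSpace Ω] [MeasurableSpace E]
    [MeasurableSpace F] {P : Measure Ω} [IsProbabilityMeasure P] {X : ℕ → Ω → E} {Y : ℕ → Ω → F}
    (hX : ∀ j, Measurable (X j)) (hY : ∀ j, Measurable (Y j))
    (hind : ∀ n, IndepFun (fun ω => ((fun j => X j ω), fun j : Fin n => Y j ω)) (Y n) P)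
    {e : E × F → ℝ≥0∞} (he : Measurable e) {g : E → ℝ≥0∞} (hgm : Measurable g)
    (hg : ∀ n x, ∫⁻ ω, e (x, Y n ω) ∂P = g x) (n : ℕ) {Z : (ℕ → E) → ℝ≥0∞} (hZ : Measurable Z) :
    ∫⁻ ω, Z (fun j => X j ω) * ∏ j ∈ Finset.range n, e (X j ω, Y j ω) ∂P =
      ∫⁻ ω, Z (fun j => X j ω) * ∏ j ∈ Finset.range n, g (X j ω) ∂P := by
  -- Integrating out the last mark leaves the factor `g (X n)`, which depends on the positions only
  -- and is absorbed into `Z`.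
  induction n generalizing Z with
  | zero => simp
  | succ n ih =>
    set f : ((ℕ → E) × (Fin n → F)) × F → ℝ≥0∞ := fun q =>
      (Z q.1.1 * ∏ j : Fin n, e (q.1.1 j, q.1.2 j)) * e (q.1.1 n, q.2) with hf
    have hfm : Measurable f := by
      refine ((hZ.comp measurable_fst.fst).mul ?_).mul ?_
      · refine Finset.measurable_fun_prod _ fun j _ => he.comp ?_
        exact ((measurable_pi_apply _).comp measurable_fst.fst).prodMk
          ((measurable_pi_apply j).comp measurable_fst.snd)
      · exact he.comp (((measurable_pi_apply _).comp measurable_fst.fst).prodMk measurable_snd)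
    have hW : Measurable (fun ω => ((fun j => X j ω), fun j : Fin n => Y j ω)) :=
      (measurable_pi_lambda _ hX).prodMk (measurable_pi_lambda _ fun j => hY j)
    have e1 : ∀ ω, Z (fun j => X j ω) * ∏ j ∈ Finset.range (n + 1), e (X j ω, Y j ω) =
        f (((fun j => X j ω), fun j : Fin n => Y j ω), Y n ω) := by
      intro ω
      simp only [hf]
      rw [Finset.prod_range_succ, ← mul_assoc,
        Fin.prod_univ_eq_prod_range (fun j => e (X j ω, Y j ω))]
    simp_rw [e1]
    rw [lintegral_comp_of_indepFun hW (hY n) (hind n) hfm]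
    have e2 : ∀ ω, ∫⁻ ω', f (((fun j => X j ω), fun j : Fin n => Y j ω), Y n ω') ∂P =
        (Z (fun j => X j ω) * g (X n ω)) * ∏ j ∈ Finset.range n, e (X j ω, Y j ω) := by
      intro ω
      simp only [hf]
      have hm : Measurable fun ω' => e (X n ω, Y n ω') :=
        he.comp (measurable_const.prodMk (hY n))
      rw [lintegral_const_mul _ hm, hg,
        Fin.prod_univ_eq_prod_range (fun j => e (X j ω, Y j ω))]
      ring
    simp_rw [e2]
    rw [ih (Z := fun x => Z x * g (x n)) (hZ.mul (hgm.comp (measurable_pi_apply n)))]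
    refine lintegral_congr fun ω => ?_
    rw [Finset.prod_range_succ]
    ring

theorem tendsto_prod_expNeg (f : ℕ → ℝ≥0∞) :
    Tendsto (fun n => ∏ j ∈ Finset.range n, expNeg (f j)) atTop (𝓝 (expNeg (∑' j, f j))) := by
  simp_rw [← expNeg_sum]
  exact (continuous_expNeg.tendsto _).comp (ENNReal.tendsto_nat_tsum f)

theorem tendsto_lintegral_prod_expNeg {Ω : Type*} [MeasurableSpace Ω] {P : Measure Ω}
    [IsProbabilityMeasure P] {f : ℕ → Ω → ℝ≥0∞} (hf : ∀ j, Measurable (f j)) :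
    Tendsto (fun n => ∫⁻ ω, ∏ j ∈ Finset.range n, expNeg (f j ω) ∂P) atTop
      (𝓝 (∫⁻ ω, expNeg (∑' j, f j ω) ∂P)) := by
  refine tendsto_lintegral_of_dominated_convergence (fun _ => 1) ?_ ?_ (by simp) ?_
  · exact fun n => Finset.measurable_fun_prod _ fun j _ => measurable_expNeg.comp (hf j)
  · exact fun n => Eventually.of_forall fun ω => Finset.prod_le_one' fun j _ => expNeg_le_one _
  · exact Eventually.of_forall fun ω => tendsto_prod_expNeg _

/-- The Laplace functional of a planar Poisson point process with independent marks. -/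
theorem IsPlanarPPP.lintegral_expNeg_tsum_marks {Ω F : Type*} [MeasurableSpace Ω]
    [MeasurableSpace F] {P : Measure Ω} [IsProbabilityMeasure P] {lam : ℝ}
    {X : ℕ → Ω → EuclideanSpace ℝ (Fin 2)} {Y : ℕ → Ω → F} (hX : IsPlanarPPP P lam X)
    (hY : ∀ j, Measurable (Y j))
    (hind : ∀ n, IndepFun (fun ω => ((fun j => X j ω), fun j : Fin n => Y j ω)) (Y n) P)
    {k : EuclideanSpace ℝ (Fin 2) × F → ℝ≥0∞} (hk : Measurable k)
    {h : EuclideanSpace ℝ (Fin 2) → ℝ≥0∞} (hh : Measurable h)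
    (hkh : ∀ n x, ∫⁻ ω, expNeg (k (x, Y n ω)) ∂P = expNeg (h x)) :
    ∫⁻ ω, expNeg (∑' j, k (X j ω, Y j ω)) ∂P =
      expNeg (ENNReal.ofReal lam * ∫⁻ x, 1 - expNeg (h x)) := by
  rw [← hX.lintegral_expNeg_tsum hh]
  have h1 := tendsto_lintegral_prod_expNeg (P := P) (f := fun j ω => k (X j ω, Y j ω))
    fun j => hk.comp ((hX.measurable_pt j).prodMk (hY j))
  have h2 := tendsto_lintegral_prod_expNeg (P := P) (f := fun j ω => h (X j ω))
    fun j => hh.comp (hX.measurable_pt j)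
  -- Finite products with and without marks have equal integrals, so their limits agree, and the
  -- unmarked limit is already known.
  refine tendsto_nhds_unique h1 (h2.congr fun n => ?_)
  have := lintegral_prod_marks hX.measurable_pt hY hind (measurable_expNeg.comp hk)
    (measurable_expNeg.comp hh) hkh n (Z := fun _ => 1) measurable_const
  simpa using this.symm

/-! ### Tail and Laplace transform of exponential fading. -/

theorem expMeasure_Ioi {x : ℝ} (hx : 0 ≤ x) :
    expMeasure 1 (Set.Ioi x) = ENNReal.ofReal (Real.exp (-x)) := by
  have := isProbabilityMeasure_expMeasure one_pos
  have h := cdf_expMeasure_eq one_pos x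
  rw [if_pos hx, cdf_eq_real, one_mul] at h
  have h2 := probReal_compl_eq_one_sub (μ := expMeasure 1) (measurableSet_Iic (a := x))
  rw [Set.compl_Iic, h, sub_sub_cancel] at h2
  rw [← h2, ofReal_measureReal]

/-- The cut-off `max y 0` mirrors the truncation of received powers by `ENNReal.ofReal`; the
exponential law does not charge negative `y`. -/
theorem lintegral_expMeasure_exp {c : ℝ} (hc : 0 ≤ c) :
    ∫⁻ y, ENNReal.ofReal (Real.exp (-(c * max y 0))) ∂(expMeasure 1) =
      ENNReal.ofReal (1 / (1 + c)) := by
  have hpdf : expMeasure 1 = volume.withDensity (exponentialPDF 1) := rfl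
  have hpm : Measurable (exponentialPDF 1) := (measurable_exponentialPDFReal 1).ennreal_ofReal
  rw [hpdf, lintegral_withDensity_eq_lintegral_mul _ hpm (by fun_prop)]
  have e : ∀ y : ℝ, (exponentialPDF 1 * fun y => ENNReal.ofReal (Real.exp (-(c * max y 0)))) y =
      (Set.Ici (0 : ℝ)).indicator (fun y => ENNReal.ofReal (Real.exp (-(1 + c) * y))) y := by
    intro y
    rw [Pi.mul_apply, exponentialPDF_eq]
    by_cases hy : 0 ≤ y
    · rw [if_pos hy, Set.indicator_of_mem (by exact hy), max_eq_left hy,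
        ← ENNReal.ofReal_mul (by positivity), one_mul, one_mul, ← Real.exp_add]
      congr 2
      ring
    · rw [if_neg hy, Set.indicator_of_notMem (by exact hy)]
      simp
  simp_rw [e]
  rw [lintegral_indicator measurableSet_Ici, setLIntegral_congr Ioi_ae_eq_Ici.symm,
    lintegral_exp_neg_mul_Ioi (by linarith)]

/-! ### Splitting the randomness by node. -/

namespace TSANetwork

variable {Ω : Type*} (N : TSANetwork Ω) (p : TSAParams)

/-- The σ-algebras of the sources of randomness, with the environment split into its parts. -/
@[reducible] def splitAlgebra : Option ℕ ⊕ {k : TSASeed // k ≠ .env} → MeasurableSpace Ω :=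
  Sum.elim N.envAlgebra fun k => N.seedAlgebra k

/-- The node to which a source of randomness belongs. The positions and the tagged source share
the label `none`. -/
def owner : Option ℕ ⊕ {k : TSASeed // k ≠ .env} → Option ℕ
  | .inl i => i
  | .inr ⟨.env, _⟩ => none
  | .inr ⟨.fading i _, _⟩ => i
  | .inr ⟨.access i _, _⟩ => i
  | .inr ⟨.decode i _, _⟩ => i

/-- The σ-algebra generated by a set of sources of randomness. -/
@[reducible] def splitSup (S : Set (Option ℕ ⊕ {k : TSASeed // k ≠ .env})) : MeasurableSpace Ω :=
  ⨆ k ∈ S, N.splitAlgebra k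

variable {S : Set (Option ℕ ⊕ {k : TSASeed // k ≠ .env})}

theorem splitAlgebra_le_splitSup {k : Option ℕ ⊕ {k : TSASeed // k ≠ .env}} (hk : k ∈ S) :
    N.splitAlgebra k ≤ N.splitSup S := le_iSup₂_of_le k hk le_rfl

theorem measurable_fading_splitSup {i : Option ℕ} {t : ℕ}
    (h : Sum.inr ⟨.fading i t, TSASeed.noConfusion⟩ ∈ S) :
    Measurable[N.splitSup S] (N.fading i t) :=
  (comap_measurable (N.fading i t)).mono (N.splitAlgebra_le_splitSup h) le_rfl

theorem measurable_access_splitSup {i : Option ℕ} {t : ℕ}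
    (h : Sum.inr ⟨.access i t, TSASeed.noConfusion⟩ ∈ S) :
    Measurable[N.splitSup S] (N.access i t) :=
  (comap_measurable (N.access i t)).mono (N.splitAlgebra_le_splitSup h) le_rfl

theorem measurable_decode_splitSup {i : Option ℕ} {t : ℕ}
    (h : Sum.inr ⟨.decode i t, TSASeed.noConfusion⟩ ∈ S) :
    Measurable[N.splitSup S] (N.decode i t) :=
  (comap_measurable (N.decode i t)).mono (N.splitAlgebra_le_splitSup h) le_rfl

theorem measurable_pos_splitSup (h : Sum.inl none ∈ S) (j : ℕ) :
    Measurable[N.splitSup S] (N.pos j) := by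
  have h1 : Measurable[N.splitAlgebra (Sum.inl none)] (fun ω j => N.pos j ω) :=
    comap_measurable _
  exact ((measurable_pi_apply j).comp h1).mono (N.splitAlgebra_le_splitSup h) le_rfl

/-- An interferer's activity uses only its own rate, initial age and coins, neither the positions
nor any fading; the independence of the marks rests on this. -/
theorem measurable_active_splitSup {j t : ℕ} (h0 : Sum.inl (some j) ∈ S)
    (ha : ∀ s, Sum.inr ⟨.access (some j) s, TSASeed.noConfusion⟩ ∈ S)
    (hd : ∀ s, Sum.inr ⟨.decode (some j) s, TSASeed.noConfusion⟩ ∈ S) :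
    Measurable[N.splitSup S] (N.active p (some j) (N.rate j) t) := by
  have h1 : Measurable[N.splitAlgebra (Sum.inl (some j))]
      (fun ω => (N.rate j ω, N.initAge (some j) ω)) := comap_measurable _
  have h2 : Measurable[N.splitSup S] (fun ω => (N.rate j ω, N.initAge (some j) ω)) :=
    h1.mono (N.splitAlgebra_le_splitSup h0) le_rfl
  have hage := @measurable_age Ω N p (N.splitSup S) (some j) (N.rate j) t
    (measurable_snd.comp h2) (measurable_fst.comp h2)
    (fun s _ => N.measurable_access_splitSup (ha s))
    (fun s _ => N.measurable_decode_splitSup (hd s))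
  exact @measurable_active Ω N p (N.splitSup S) (some j) (N.rate j) t hage
    (N.measurable_access_splitSup (ha t))

theorem envAlgebra_le (i : Option ℕ) : N.envAlgebra i ≤ N.environment := by
  cases i with
  | none => exact le_sup_of_le_left le_sup_left
  | some j =>
    have h1 : Measurable[N.environment] (N.rate j) :=
      (N.measurable_rate_topology j).mono le_sup_left le_rfl
    exact (h1.prodMk (N.measurable_initAge_environment (some j))).comap_le

namespace IsMeanField

variable {N p} [MeasurableSpace Ω] {P : Measure Ω} {ρ : ℝ≥0∞}

/-- `indep_seeds` treats the environment as one block and `indep_env` splits that block; together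
they make all pieces jointly independent. -/
theorem iIndep_splitAlgebra (h : N.IsMeanField p P ρ) : iIndep N.splitAlgebra P :=
  h.indep_env.sumElim (k₀ := TSASeed.env) h.indep_seeds N.envAlgebra_le

theorem splitAlgebra_le (h : N.IsMeanField p P ρ)
    (k : Option ℕ ⊕ {k : TSASeed // k ≠ .env}) : N.splitAlgebra k ≤ ‹MeasurableSpace Ω› := by
  rcases k with i | k
  · exact (N.envAlgebra_le i).trans h.environment_le
  · exact h.seedAlgebra_le k

theorem indepFun_of_splitSup (h : N.IsMeanField p P ρ)
    {S T : Set (Option ℕ ⊕ {k : TSASeed // k ≠ .env})} (hST : Disjoint S T)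
    {β γ : Type*} [MeasurableSpace β] [MeasurableSpace γ] {f : Ω → β} {g : Ω → γ}
    (hf : Measurable[N.splitSup S] f) (hg : Measurable[N.splitSup T] g) : IndepFun f g P :=
  indep_of_indep_of_le_left (indep_of_indep_of_le_right
    (indep_iSup_of_disjoint h.splitAlgebra_le h.iIndep_splitAlgebra hST) hg.comap_le) hf.comap_le

end IsMeanField

end TSANetwork

/-! ### Mean activity, Laplace transform of the interference, and success probability. -/

theorem TSAParams.Omega_nonneg {p : TSAParams} (hα : 2 < p.α) : 0 ≤ p.Omega := by
  have hδ0 : 0 < p.δ := div_pos two_pos (by linarith)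
  have hδ1 : p.δ < 1 := by rw [TSAParams.δ, div_lt_one (by linarith)]; exact hα
  have : 0 < Real.sin (Real.pi * p.δ) :=
    Real.sin_pos_of_pos_of_lt_pi (by positivity) (by nlinarith [Real.pi_pos])
  rw [TSAParams.Omega]
  positivity

theorem TSANetwork.measurable_interference_of {Ω : Type*} (N : TSANetwork Ω) (p : TSAParams)
    [MeasurableSpace Ω] {t : ℕ} (hf : ∀ j, Measurable (N.fading (some j) t))
    (ha : ∀ j, Measurable (N.active p (some j) (N.rate j) t)) (hp : ∀ j, Measurable (N.pos j)) :
    Measurable (N.interference p t) :=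
  Measurable.tsum fun j => (((hf j).mul (ha j)).mul ((hp j).norm.pow_const _)).ennreal_ofReal

namespace TSANetwork.IsMeanField

variable {Ω : Type*} {N : TSANetwork Ω} {p : TSAParams} [MeasurableSpace Ω] {P : Measure Ω}
  {ρ : ℝ≥0∞}

theorem measurable_active (h : N.IsMeanField p P ρ) (j t : ℕ) :
    Measurable (N.active p (some j) (N.rate j) t) :=
  N.measurable_active p (N.measurable_age p (h.measurable_initAge _) (h.measurable_rate j)
    (fun s _ => h.measurable_access _ s) fun s _ => h.measurable_decode _ s)
    (h.measurable_access _ t)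

theorem measurable_interference (h : N.IsMeanField p P ρ) (t : ℕ) :
    Measurable (N.interference p t) :=
  N.measurable_interference_of p (fun _ => h.measurable_fading _ t)
    (fun j => h.measurable_active j t) h.ppp.measurable_pt

theorem measurableSet_success (h : N.IsMeanField p P ρ) (t : ℕ) :
    MeasurableSet {ω | ENNReal.ofReal p.θ < N.sinr p ρ t ω} :=
  measurableSet_lt measurable_const
    (((h.measurable_fading none t).mul_const _).ennreal_ofReal.div
      ((h.measurable_interference t).add_const _))

theorem measurable_serviceRate_topology :
    Measurable[N.topology] (N.serviceRate p P ρ) :=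
  stronglyMeasurable_condExp.measurable

theorem measurable_serviceRate (h : N.IsMeanField p P ρ) : Measurable (N.serviceRate p P ρ) :=
  measurable_serviceRate_topology.mono h.topology_le le_rfl

theorem measure_lt_fading (h : N.IsMeanField p P ρ) (hr : 0 < p.r) (hθ : 0 < p.θ) (t : ℕ)
    (b : ℝ≥0∞) :
    P {ω | ENNReal.ofReal p.θ * b < ENNReal.ofReal (N.fading none t ω * p.r ^ (-p.α))} =
      expNeg (ENNReal.ofReal (p.θ * p.r ^ p.α) * b) := by
  have hra : 0 < p.r ^ p.α := Real.rpow_pos_of_pos hr _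
  rcases eq_or_ne b ⊤ with rfl | hb
  · rw [ENNReal.mul_top (by simpa using hθ), ENNReal.mul_top (by simpa using by positivity),
      expNeg_top]
    simp
  · obtain ⟨c, rfl⟩ : ∃ c : ℝ≥0, (c : ℝ≥0∞) = b := ⟨_, ENNReal.coe_toNNReal hb⟩
    rw [← ENNReal.ofReal_coe_nnreal, ← ENNReal.ofReal_mul hθ.le,
      ← ENNReal.ofReal_mul (by positivity), expNeg_ofReal (by positivity),
      ← expMeasure_Ioi (by positivity), ← (h.fading_law none t).map_eq,
      Measure.map_apply (h.measurable_fading none t) measurableSet_Ioi]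
    congr 1
    ext ω
    rw [Set.mem_ofPred_eq, ENNReal.ofReal_lt_ofReal_iff_of_nonneg (by positivity),
      Set.mem_preimage, Set.mem_Ioi, Real.rpow_neg hr.le, ← div_eq_mul_inv, lt_div_iff₀ hra]
    rw [show p.θ * (c : ℝ) * p.r ^ p.α = p.θ * p.r ^ p.α * c by ring]

variable [IsProbabilityMeasure P]

theorem serviceRate_mem_Icc (h : N.IsMeanField p P ρ) :
    ∀ᵐ ω ∂P, N.serviceRate p P ρ ω ∈ Set.Icc (0 : ℝ) 1 := by
  set s := {ω | ENNReal.ofReal p.θ < N.sinr p ρ 0 ω}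
  have hi : Integrable (s.indicator fun _ => (1 : ℝ)) P :=
    (integrable_const 1).indicator (h.measurableSet_success 0)
  have h0 : 0 ≤ᵐ[P] N.serviceRate p P ρ :=
    condExp_nonneg (Eventually.of_forall fun ω => Set.indicator_nonneg (fun _ _ => zero_le_one) ω)
  have h1 : N.serviceRate p P ρ ≤ᵐ[P] P[fun _ => (1 : ℝ)|N.topology] :=
    condExp_mono hi (integrable_const 1)
      (Eventually.of_forall fun ω => Set.indicator_le_self' (fun _ _ => zero_le_one) ω)
  rw [condExp_const h.topology_le] at h1
  filter_upwards [h0, h1] with ω a b using ⟨a, b⟩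

/-- The conditional probability `μ_0` is a function of the topology, hence an admissible service
rate in the general result. -/
theorem ae_tendsto_activeAverage (h : N.IsMeanField p P ρ) (hη : 0 ≤ p.η) (hη' : p.η ≤ 1) :
    ∀ᵐ ω ∂P, Tendsto (fun T => N.activeAverage p P ρ T ω) atTop
      (𝓝 (p.η / (1 + p.A * p.η * N.serviceRate p P ρ ω))) :=
  h.ae_tendsto_active_average hη hη' none (measurable_serviceRate_topology.mono le_sup_left le_rfl)
    h.serviceRate_mem_Icc

theorem activeFraction_ae_eq (h : N.IsMeanField p P ρ) (hη : 0 ≤ p.η) (hη' : p.η ≤ 1) :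
    N.activeFraction p P ρ =ᵐ[P] fun ω => p.η / (1 + p.A * p.η * N.serviceRate p P ρ ω) := by
  filter_upwards [h.ae_tendsto_activeAverage hη hη'] with ω hω using hω.limsup_eq

theorem activeProb_eq (h : N.IsMeanField p P ρ) (hη : 0 ≤ p.η) (hη' : p.η ≤ 1) :
    N.activeProb p P ρ = ∫ ω, p.η / (1 + p.A * p.η * N.serviceRate p P ρ ω) ∂P :=
  integral_congr_ae (h.activeFraction_ae_eq hη hη')

theorem activeProb_eq_rateLaw (h : N.IsMeanField p P ρ) (hη : 0 ≤ p.η) (hη' : p.η ≤ 1) :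
    N.activeProb p P ρ =
      ∫ u in Set.Icc (0 : ℝ) 1, p.η / (1 + p.A * p.η * u) ∂(N.rateLaw p P ρ) := by
  have hm := h.measurable_serviceRate
  have hF : ∀ᵐ u ∂(N.rateLaw p P ρ), u ∈ Set.Icc (0 : ℝ) 1 :=
    (ae_map_iff hm.aemeasurable measurableSet_Icc).2 h.serviceRate_mem_Icc
  rw [h.activeProb_eq hη hη', Measure.restrict_eq_self_of_ae_mem hF, rateLaw,
    integral_map hm.aemeasurable (by fun_prop : Measurable _).aestronglyMeasurable]

theorem rate_mem_Icc (h : N.IsMeanField p P ρ) (j : ℕ) :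
    ∀ᵐ ω ∂P, N.rate j ω ∈ Set.Icc (0 : ℝ) 1 := by
  refine (ae_map_iff (h.measurable_rate j).aemeasurable measurableSet_Icc).1 ?_
  rw [h.rate_law j, rateLaw]
  exact (ae_map_iff h.measurable_serviceRate.aemeasurable measurableSet_Icc).2
    h.serviceRate_mem_Icc

theorem integrable_active (h : N.IsMeanField p P ρ) (j t : ℕ) :
    Integrable (N.active p (some j) (N.rate j) t) P := by
  refine Integrable.of_bound (h.measurable_active j t).aestronglyMeasurable 1 ?_
  refine Eventually.of_forall fun ω => ?_
  rw [Real.norm_eq_abs, abs_of_nonneg (N.active_nonneg _ _ _ _ _)]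
  exact N.active_le_one _ _ _ _ _

/-- Steadiness fixes the law of the age, hence the probability of being eligible; the access coin is
independent of the age and multiplies this by `η`. -/
theorem integral_active_eq_integral_active_zero (h : N.IsMeanField p P ρ) (hη : 0 ≤ p.η)
    (j t : ℕ) : ∫ ω, N.active p (some j) (N.rate j) t ω ∂P =
      ∫ ω, N.active p (some j) (N.rate j) 0 ω ∂P := by
  set elig : ℕ → Ω → ℝ := fun t ω =>
    if p.A < N.age p (some j) (N.rate j) t ω then (1 : ℝ) else 0 with helig
  have hagem : ∀ t, Measurable (N.age p (some j) (N.rate j) t) := fun t =>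
    N.measurable_age p (h.measurable_initAge _) (h.measurable_rate j)
      (fun s _ => h.measurable_access _ s) fun s _ => h.measurable_decode _ s
  have hm : ∀ t, Measurable (elig t) := fun t => N.measurable_eligible p (hagem t)
  have hi : ∀ t, Integrable (elig t) P := fun t => by
    refine Integrable.of_bound (hm t).aestronglyMeasurable 1 (Eventually.of_forall fun ω => ?_)
    simp only [helig]
    split_ifs <;> simp
  have hact : ∀ t, ∫ ω, N.active p (some j) (N.rate j) t ω ∂P = p.η * ∫ ω, elig t ω ∂P := by
    intro t
    have hmt : Measurable[N.seedSup (past (some j) t)] (elig t) :=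
      @measurable_eligible Ω N p (N.seedSup (past (some j) t)) _ _ _
        (N.measurable_age_seedSup p ((N.measurable_rate_topology j).mono le_sup_left le_rfl)
          (subset_refl _))
    have hk : TSASeed.access (some j) t ∉ past (some j) t := by
      rintro (hk | ⟨r, hr, hk | hk⟩)
      · cases hk
      · cases hk; exact lt_irrefl _ hr
      · cases hk
    have h0 := integral_comp_eq_zero_of_indepFun (hm t) (h.measurable_access (some j) t)
      (h.indepFun_of_seedSup hk hmt (comap_measurable _))
      (f := fun q : ℝ × Bool => q.1 * ((if q.2 = true then (1 : ℝ) else 0) - p.η))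
      (measurable_fst.mul (Measurable.sub_const
          ((Measurable.of_discrete (f := fun b : Bool => if b = true then (1 : ℝ) else 0)).comp
            measurable_snd) _))
      (Eventually.of_forall fun ω => h.integral_access_sub hη (some j) t (elig t ω))
    have e : ∀ ω, elig t ω * ((if N.access (some j) t ω = true then (1 : ℝ) else 0) - p.η) =
        N.active p (some j) (N.rate j) t ω - p.η * elig t ω := by
      intro ω
      simp only [helig, active]
      by_cases h1 : p.A < N.age p (some j) (N.rate j) t ω <;>
        by_cases h2 : N.access (some j) t ω = true <;> simp [h1, h2]
    simp only [e] at h0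
    rw [integral_sub (h.integrable_active j t) ((hi t).const_mul _), integral_const_mul] at h0
    linarith
  have hst : ∀ t, ∫ ω, elig t ω ∂P = ∫ ω, elig 0 ω ∂P := by
    intro t
    have hf : Measurable fun q : ℝ × ℕ => if p.A < q.2 then (1 : ℝ) else 0 :=
      Measurable.ite (measurableSet_lt measurable_const measurable_snd) measurable_const
        measurable_const
    have e1 := integral_map ((h.measurable_rate j).prodMk (hagem t)).aemeasurable
      (μ := P) hf.aestronglyMeasurable
    have e2 := integral_map ((h.measurable_rate j).prodMk (hagem 0)).aemeasurable
      (μ := P) hf.aestronglyMeasurable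
    rw [h.steady j t] at e1
    rw [h.steady j 0] at e2
    exact e1.symm.trans e2
  rw [hact, hact, hst]

/-- A mean that is constant in time equals the mean of every time average, and these averages are
bounded and converge almost surely. The limit depends on the rate alone, whose law is that of the
tagged link. -/
theorem integral_active (h : N.IsMeanField p P ρ) (hη : 0 ≤ p.η) (hη' : p.η ≤ 1) (j t : ℕ) :
    ∫ ω, N.active p (some j) (N.rate j) t ω ∂P = N.activeProb p P ρ := by
  rw [h.integral_active_eq_integral_active_zero hη j t]
  set M := ∫ ω, N.active p (some j) (N.rate j) 0 ω ∂P with hM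
  have hconv := h.ae_tendsto_active_average hη hη' (some j)
    ((N.measurable_rate_topology j).mono le_sup_left le_rfl) (h.rate_mem_Icc j)
  have hlim : Tendsto (fun T : ℕ => ∫ ω, (∑ t ∈ Finset.range T,
      N.active p (some j) (N.rate j) t ω) / T ∂P) atTop
      (𝓝 (∫ ω, p.η / (1 + p.A * p.η * N.rate j ω) ∂P)) := by
    refine tendsto_integral_of_dominated_convergence (fun _ => 1) ?_ (integrable_const _) ?_ hconv
    · exact fun T => ((Finset.measurable_fun_sum _ fun t _ =>
        h.measurable_active j t).div_const _).aestronglyMeasurable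
    · refine fun T => Eventually.of_forall fun ω => ?_
      have h0 : 0 ≤ ∑ t ∈ Finset.range T, N.active p (some j) (N.rate j) t ω :=
        Finset.sum_nonneg fun t _ => N.active_nonneg _ _ _ _ _
      have h1 : ∑ t ∈ Finset.range T, N.active p (some j) (N.rate j) t ω ≤ T := by
        refine (Finset.sum_le_sum fun t _ => N.active_le_one p (some j) (N.rate j) t ω).trans ?_
        simp
      rw [Real.norm_eq_abs, abs_of_nonneg (by positivity)]
      exact div_le_one_of_le₀ h1 (Nat.cast_nonneg T)
  have hconst : Tendsto (fun T : ℕ => ∫ ω, (∑ t ∈ Finset.range T,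
      N.active p (some j) (N.rate j) t ω) / T ∂P) atTop (𝓝 M) := by
    refine tendsto_const_nhds.congr' ?_
    filter_upwards [eventually_gt_atTop 0] with T hT
    have hT' : (T : ℝ) ≠ 0 := by exact_mod_cast hT.ne'
    rw [integral_div, integral_finsetSum _ fun t _ => h.integrable_active j t]
    simp_rw [h.integral_active_eq_integral_active_zero hη j]
    rw [Finset.sum_const, Finset.card_range, nsmul_eq_mul, ← hM]
    field_simp
  rw [tendsto_nhds_unique hconst hlim, h.activeProb_eq hη hη']
  have hf : Measurable fun u : ℝ => p.η / (1 + p.A * p.η * u) := by fun_prop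
  have e1 := integral_map (h.measurable_rate j).aemeasurable (μ := P) hf.aestronglyMeasurable
  have e2 := integral_map h.measurable_serviceRate.aemeasurable (μ := P) hf.aestronglyMeasurable
  rw [h.rate_law j, rateLaw] at e1
  exact e1.symm.trans e2

theorem activeProb_mem_Icc (h : N.IsMeanField p P ρ) (hη : 0 ≤ p.η) (hη' : p.η ≤ 1) :
    N.activeProb p P ρ ∈ Set.Icc (0 : ℝ) 1 := by
  rw [← h.integral_active hη hη' 0 0]
  refine ⟨integral_nonneg fun ω => N.active_nonneg _ _ _ _ _, ?_⟩
  have := integral_mono (h.integrable_active 0 0) (integrable_const (1 : ℝ))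
    fun ω => N.active_le_one p (some 0) (N.rate 0) 0 ω
  simpa using this

/-- Laplace transform of the received power of an interferer with path loss `c`. -/
theorem lintegral_expNeg_fading_active (h : N.IsMeanField p P ρ) (hη : 0 ≤ p.η) (hη' : p.η ≤ 1)
    (j t : ℕ) {s c : ℝ} (hs : 0 ≤ s) (hc : 0 ≤ c) :
    ∫⁻ ω, expNeg (ENNReal.ofReal s * ENNReal.ofReal (N.fading (some j) t ω *
        N.active p (some j) (N.rate j) t ω * c)) ∂P =
      ENNReal.ofReal (1 - N.activeProb p P ρ * (s * c / (1 + s * c))) := by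
  set ν := N.active p (some j) (N.rate j) t with hν
  have hνm : Measurable ν := h.measurable_active j t
  have hind : IndepFun ν (N.fading (some j) t) P := by
    refine h.indepFun_of_splitSup (S := {k | k ≠ Sum.inr ⟨.fading (some j) t, TSASeed.noConfusion⟩})
      (T := {Sum.inr ⟨.fading (some j) t, TSASeed.noConfusion⟩}) ?_ ?_ ?_
    · rw [Set.disjoint_singleton_right]; simp
    · exact N.measurable_active_splitSup p (by simp) (by simp [Subtype.ext_iff])
        (by simp [Subtype.ext_iff])
    · exact N.measurable_fading_splitSup (by simp)
  have hf : Measurable fun q : ℝ × ℝ =>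
      expNeg (ENNReal.ofReal s * ENNReal.ofReal (q.2 * q.1 * c)) :=
    measurable_expNeg.comp (by fun_prop)
  rw [lintegral_comp_of_indepFun hνm (h.measurable_fading _ _) hind hf]
  have hκ : 0 ≤ s * c / (1 + s * c) := by positivity
  have hκ1 : s * c / (1 + s * c) ≤ 1 := by rw [div_le_one (by positivity)]; linarith
  have hinner : ∀ ω, ∫⁻ ω', expNeg (ENNReal.ofReal s *
      ENNReal.ofReal (N.fading (some j) t ω' * ν ω * c)) ∂P =
      ENNReal.ofReal (1 - ν ω * (s * c / (1 + s * c))) := by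
    intro ω
    have hν0 : 0 ≤ ν ω := N.active_nonneg _ _ _ _ _
    -- On `{0, 1}` the function `1 / (1 + s ν c)` is affine in `ν`; therefore only the mean activity
    -- survives the integration.
    have hν01 : ν ω = 0 ∨ ν ω = 1 := by
      simp only [hν, active]
      split_ifs <;> simp
    have hfm : Measurable fun y : ℝ =>
        expNeg (ENNReal.ofReal s * ENNReal.ofReal (y * ν ω * c)) :=
      measurable_expNeg.comp (by fun_prop)
    rw [(h.fading_law (some j) t).lintegral_comp
      (f := fun y => expNeg (ENNReal.ofReal s * ENNReal.ofReal (y * ν ω * c))) hfm.aemeasurable]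
    have e : ∀ y : ℝ, expNeg (ENNReal.ofReal s * ENNReal.ofReal (y * ν ω * c)) =
        ENNReal.ofReal (Real.exp (-(s * ν ω * c * max y 0))) := by
      intro y
      rw [← expNeg_ofReal (by positivity), ← ENNReal.ofReal_mul hs]
      rcases le_total 0 y with hy | hy
      · rw [max_eq_left hy]
        congr 2
        ring
      · rw [max_eq_right hy, mul_zero, ENNReal.ofReal_zero, ENNReal.ofReal_of_nonpos]
        have : y * ν ω * c ≤ 0 := by
          rw [mul_assoc]
          exact mul_nonpos_of_nonpos_of_nonneg hy (by positivity)
        exact mul_nonpos_of_nonneg_of_nonpos hs this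
    simp_rw [e]
    rw [lintegral_expMeasure_exp (by positivity)]
    congr 1
    have : (1 + s * c) ≠ 0 := by positivity
    rcases hν01 with h0 | h0 <;> rw [h0]
    · simp
    · rw [mul_one, one_mul]
      field_simp
      ring
  simp_rw [hinner]
  have hi : Integrable (fun ω => 1 - ν ω * (s * c / (1 + s * c))) P :=
    (integrable_const 1).sub ((h.integrable_active j t).mul_const _)
  rw [← ofReal_integral_eq_lintegral_ofReal hi]
  · rw [integral_sub (integrable_const 1) ((h.integrable_active j t).mul_const _),
      integral_mul_const, h.integral_active hη hη']
    simp
  · refine Eventually.of_forall fun ω => ?_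
    have : ν ω * (s * c / (1 + s * c)) ≤ 1 :=
      mul_le_one₀ (N.active_le_one _ _ _ _ _) hκ hκ1
    simpa using this

/-- Laplace transform of the interference. -/
theorem lintegral_expNeg_interference (h : N.IsMeanField p P ρ) (hα : 2 < p.α) (hη : 0 ≤ p.η)
    (hη' : p.η ≤ 1) (t : ℕ) {s : ℝ} (hs : 0 < s) :
    ∫⁻ ω, expNeg (ENNReal.ofReal s * N.interference p t ω) ∂P =
      expNeg (ENNReal.ofReal p.lam * ENNReal.ofReal (N.activeProb p P ρ *
        (Real.pi * s ^ p.δ * p.Omega))) := by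
  set φ := N.activeProb p P ρ with hφ
  obtain ⟨hφ0, hφ1⟩ := h.activeProb_mem_Icc hη hη'
  set κ : EuclideanSpace ℝ (Fin 2) → ℝ := fun x =>
    s * ‖x‖ ^ (-p.α) / (1 + s * ‖x‖ ^ (-p.α)) with hκ
  have hκm : Measurable κ := by fun_prop
  have hκ0 : ∀ x, 0 ≤ κ x := fun x => by simp only [hκ]; positivity
  have hκ1 : ∀ x, κ x < 1 := fun x => by
    have : 0 ≤ s * ‖x‖ ^ (-p.α) := by positivity
    simp only [hκ]
    rw [div_lt_one (by positivity)]
    linarith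
  have hφκ0 : ∀ x, 0 ≤ φ * κ x := fun x => mul_nonneg hφ0 (hκ0 x)
  have hφκ : ∀ x, φ * κ x < 1 := fun x =>
    (mul_le_of_le_one_left (hκ0 x) hφ1).trans_lt (hκ1 x)
  -- The Laplace functional wants the mark average as an exponential; the logarithm is legitimate
  -- because `φ κ < 1` strictly.
  have hexp : ∀ x, expNeg (ENNReal.ofReal (-Real.log (1 - φ * κ x))) =
      ENNReal.ofReal (1 - φ * κ x) := by
    intro x
    have h1 : 0 < 1 - φ * κ x := by linarith [hφκ x]
    rw [expNeg_ofReal, neg_neg, Real.exp_log h1]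
    have := Real.log_nonpos h1.le (by linarith [hφκ0 x])
    linarith
  have hmain : ENNReal.ofReal p.lam * ∫⁻ x : EuclideanSpace ℝ (Fin 2),
      1 - expNeg (ENNReal.ofReal (-Real.log (1 - φ * κ x))) = ENNReal.ofReal p.lam *
      ENNReal.ofReal (φ * (Real.pi * s ^ p.δ * p.Omega)) := by
    congr 1
    have e : ∀ᵐ x : EuclideanSpace ℝ (Fin 2),
        1 - expNeg (ENNReal.ofReal (-Real.log (1 - φ * κ x))) =
        ENNReal.ofReal φ * ENNReal.ofReal (s / (‖x‖ ^ p.α + s)) := by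
      -- The origin is left out: there the convention `0 ^ (-α) = 0` gives `κ = 0` instead of 1.
      have h0 : ∀ᵐ x : EuclideanSpace ℝ (Fin 2), x ≠ 0 := by
        simp [ae_iff]
      filter_upwards [h0] with x hx
      rw [hexp, ← ENNReal.ofReal_one, ← ENNReal.ofReal_sub _ (by linarith [hφκ x]),
        ← ENNReal.ofReal_mul hφ0, sub_sub_cancel]
      congr 2
      have hn : 0 < ‖x‖ ^ p.α := Real.rpow_pos_of_pos (norm_pos_iff.2 hx) _
      simp only [hκ]
      rw [Real.rpow_neg (norm_nonneg x)]
      field_simp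
    rw [lintegral_congr_ae e, lintegral_const_mul _ (by fun_prop),
      lintegral_div_norm_rpow_add hα hs, ← ENNReal.ofReal_mul hφ0]
    rfl
  rw [← hmain, ← h.ppp.lintegral_expNeg_tsum_marks
    (k := fun q => ENNReal.ofReal s * ENNReal.ofReal (q.2.1 * q.2.2 * ‖q.1‖ ^ (-p.α)))
    (Y := fun j ω => (N.fading (some j) t ω, N.active p (some j) (N.rate j) t ω))
    (h := fun x => ENNReal.ofReal (-Real.log (1 - φ * κ x)))
    (fun j => (h.measurable_fading _ _).prodMk (h.measurable_active j t)) ?_ (by fun_prop)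
    (by fun_prop) ?_]
  · exact lintegral_congr fun ω => congrArg expNeg ENNReal.tsum_mul_left.symm
  · intro n
    -- The positions have owner `none`, so they fall on the same side as the marks of the other
    -- nodes.
    refine h.indepFun_of_splitSup (S := {k | owner k ≠ some n}) (T := {k | owner k = some n})
      ?_ ?_ ?_
    · exact Set.disjoint_left.2 fun k hk hk' => hk hk'
    · refine Measurable.prodMk ?_ ?_
      · exact @measurable_pi_lambda _ _ _ (N.splitSup _) _ _
          fun j => N.measurable_pos_splitSup (by simp [owner]) j
      · refine @measurable_pi_lambda _ _ _ (N.splitSup _) _ _ fun j => ?_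
        have hj : (j : ℕ) ≠ n := j.2.ne
        exact (N.measurable_fading_splitSup (by simp [owner, hj])).prodMk
          (N.measurable_active_splitSup p (by simp [owner, hj]) (by simp [owner, hj])
            (by simp [owner, hj]))
    · exact (N.measurable_fading_splitSup (by simp [owner])).prodMk
          (N.measurable_active_splitSup p (by simp [owner]) (by simp [owner]) (by simp [owner]))
  · intro n x
    rw [hexp]
    simpa only [hκ, hφ] using h.lintegral_expNeg_fading_active hη hη' n t hs.le
      (Real.rpow_nonneg (norm_nonneg x) (-p.α))

/-- Given interference plus noise, success is a tail event of the independent exponential fading of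
the tagged source; additivity in the exponent separates the noise. -/
theorem measure_success (h : N.IsMeanField p P ρ) (hr : 0 < p.r) (hθ : 0 < p.θ) (t : ℕ) :
    P {ω | ENNReal.ofReal p.θ < N.sinr p ρ t ω} =
      expNeg (ENNReal.ofReal (p.θ * p.r ^ p.α) * ρ⁻¹) *
      ∫⁻ ω, expNeg (ENNReal.ofReal (p.θ * p.r ^ p.α) * N.interference p t ω) ∂P := by
  have hset : {ω | ENNReal.ofReal p.θ < N.sinr p ρ t ω} = {ω | ENNReal.ofReal p.θ *
      (N.interference p t ω + ρ⁻¹) < ENNReal.ofReal (N.fading none t ω * p.r ^ (-p.α))} := by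
    ext ω
    simp only [sinr, Set.mem_ofPred_eq]
    -- Since the threshold is neither 0 nor `⊤`, clearing the denominator is valid even if the
    -- denominator is 0 or `⊤`.
    exact ENNReal.lt_div_iff_mul_lt (Or.inr ENNReal.ofReal_ne_top) (Or.inr (by simpa using hθ))
  have hBm : Measurable fun ω => N.interference p t ω + ρ⁻¹ :=
    (h.measurable_interference t).add_const _
  have hind : IndepFun (fun ω => N.interference p t ω + ρ⁻¹) (N.fading none t) P := by
    refine h.indepFun_of_splitSup (S := {k | k ≠ Sum.inr ⟨.fading none t, TSASeed.noConfusion⟩})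
      (T := {Sum.inr ⟨.fading none t, TSASeed.noConfusion⟩}) ?_ ?_ ?_
    · rw [Set.disjoint_singleton_right]; simp
    · refine (measurable_id.add_const ρ⁻¹).comp (@measurable_interference_of Ω N p (N.splitSup _) t
        (fun j => N.measurable_fading_splitSup (by simp [Subtype.ext_iff]))
        (fun j => N.measurable_active_splitSup p (by simp) (by simp [Subtype.ext_iff])
          (by simp [Subtype.ext_iff]))
        (fun j => N.measurable_pos_splitSup (by simp) j))
    · exact N.measurable_fading_splitSup (by simp)
  set G : Set (ℝ≥0∞ × ℝ) :=
    {q | ENNReal.ofReal p.θ * q.1 < ENNReal.ofReal (q.2 * p.r ^ (-p.α))} with hG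
  have hGm : MeasurableSet G := measurableSet_lt (by fun_prop) (by fun_prop)
  have hsm : MeasurableSet {ω | ENNReal.ofReal p.θ * (N.interference p t ω + ρ⁻¹) <
      ENNReal.ofReal (N.fading none t ω * p.r ^ (-p.α))} :=
    (hBm.prodMk (h.measurable_fading none t)) hGm
  have hcomp := lintegral_comp_of_indepFun hBm (h.measurable_fading none t) hind
    (f := G.indicator 1) (measurable_one.indicator hGm)
  have e1 : ∫⁻ ω, G.indicator (1 : ℝ≥0∞ × ℝ → ℝ≥0∞)
      (N.interference p t ω + ρ⁻¹, N.fading none t ω) ∂P =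
      P {ω | ENNReal.ofReal p.θ * (N.interference p t ω + ρ⁻¹) <
        ENNReal.ofReal (N.fading none t ω * p.r ^ (-p.α))} := by
    rw [← lintegral_indicator_one hsm]
    rfl
  have e2 : ∀ b : ℝ≥0∞, ∫⁻ ω', G.indicator (1 : ℝ≥0∞ × ℝ → ℝ≥0∞) (b, N.fading none t ω') ∂P =
      expNeg (ENNReal.ofReal (p.θ * p.r ^ p.α) * b) := by
    intro b
    have hbm : MeasurableSet {ω | ENNReal.ofReal p.θ * b <
        ENNReal.ofReal (N.fading none t ω * p.r ^ (-p.α))} :=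
      (measurable_const.prodMk (h.measurable_fading none t)) hGm
    rw [← h.measure_lt_fading hr hθ t b, ← lintegral_indicator_one hbm]
    rfl
  rw [hset, ← e1, hcomp]
  simp_rw [e2, mul_add, expNeg_add]
  have hm : Measurable fun ω =>
      expNeg (ENNReal.ofReal (p.θ * p.r ^ p.α) * N.interference p t ω) :=
    measurable_expNeg.comp ((h.measurable_interference t).const_mul _)
  rw [lintegral_mul_const _ hm, mul_comm]

/-- The transmission success probability at signal-to-noise ratio `ρ`. -/
theorem successProb_eq (h : N.IsMeanField p P ρ) (hlam : 0 < p.lam) (hr : 0 < p.r)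
    (hα : 2 < p.α) (hθ : 0 < p.θ) (hη : 0 ≤ p.η) (hη' : p.η ≤ 1) (t : ℕ) :
    N.successProb p P ρ t = (expNeg (ENNReal.ofReal (p.θ * p.r ^ p.α) * ρ⁻¹)).toReal *
      Real.exp (-(p.load * N.activeProb p P ρ)) := by
  have hs : 0 < p.θ * p.r ^ p.α := mul_pos hθ (Real.rpow_pos_of_pos hr _)
  have e1 : N.successProb p P ρ t = P.real {ω | ENNReal.ofReal p.θ < N.sinr p ρ t ω} := by
    rw [successProb, condSuccess, integral_condExp h.topology_le,
      integral_indicator (h.measurableSet_success t)]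
    simp
  have hα0 : p.α ≠ 0 := by linarith
  have hpow : (p.θ * p.r ^ p.α) ^ p.δ = p.θ ^ p.δ * p.r ^ 2 := by
    rw [Real.mul_rpow hθ.le (by positivity), ← Real.rpow_mul hr.le, TSAParams.δ,
      mul_div_cancel₀ _ hα0, Real.rpow_two]
  have hΩ := TSAParams.Omega_nonneg hα
  have hφ0 := (h.activeProb_mem_Icc hη hη').1
  rw [e1, Measure.real, h.measure_success hr hθ t, h.lintegral_expNeg_interference hα hη hη' t hs,
    ENNReal.toReal_mul, hpow, ← ENNReal.ofReal_mul hlam.le, expNeg_ofReal (by positivity),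
    ENNReal.toReal_ofReal (by positivity)]
  congr 3
  rw [TSAParams.load]
  ring

end TSANetwork.IsMeanField

/-! ### Jensen's inequality with a variance error, and the conclusion. -/

/-- The second-order expansion of `v ↦ η / (1 + k * v)` around `m`, with exact remainder. -/
theorem div_one_add_mul_eq {η k v m : ℝ} (hv : 1 + k * v ≠ 0) (hm : 1 + k * m ≠ 0) :
    η / (1 + k * v) = η / (1 + k * m) - η * k / (1 + k * m) ^ 2 * (v - m) +
      η * k ^ 2 * (v - m) ^ 2 / ((1 + k * v) * (1 + k * m) ^ 2) := by
  field_simp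
  ring

/-- Jensen's inequality for `u ↦ η / (1 + k * u)`, with a bound on the error by the variance. -/
theorem integral_div_one_add_mul_sub_mem_Icc {Ω : Type*} [MeasurableSpace Ω] {P : Measure Ω}
    [IsProbabilityMeasure P] {U : Ω → ℝ} (hU : Measurable U)
    (hU01 : ∀ᵐ ω ∂P, U ω ∈ Set.Icc (0 : ℝ) 1) {η k : ℝ} (hη : 0 ≤ η) (hk : 0 ≤ k) :
    (∫ ω, η / (1 + k * U ω) ∂P) - η / (1 + k * ∫ ω, U ω ∂P) ∈
      Set.Icc 0 (η * k ^ 2 * variance U P / (1 + k * ∫ ω, U ω ∂P) ^ 2) := by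
  set m := ∫ ω, U ω ∂P with hm
  have hm0 : 0 ≤ m := integral_nonneg_of_ae (hU01.mono fun ω h => h.1)
  have hmk : 0 < 1 + k * m := by positivity
  have hUi : Integrable U P := by
    refine Integrable.of_bound hU.aestronglyMeasurable 1 (hU01.mono fun ω h => ?_)
    rw [Real.norm_eq_abs, abs_of_nonneg h.1]
    exact h.2
  have hUmi : Integrable (fun ω => U ω - m) P := hUi.sub (integrable_const m)
  have hsqi : Integrable (fun ω => (U ω - m) ^ 2) P := by
    refine Integrable.of_bound (hU.sub_const m |>.pow_const 2).aestronglyMeasurable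
      ((1 + m) ^ 2) (hU01.mono fun ω h => ?_)
    rw [Real.norm_eq_abs, abs_of_nonneg (sq_nonneg _)]
    nlinarith [h.1, h.2]
  have hfi : Integrable (fun ω => η / (1 + k * U ω)) P := by
    refine Integrable.of_bound (by fun_prop : Measurable _).aestronglyMeasurable η
      (hU01.mono fun ω h => ?_)
    have : 0 ≤ k * U ω := mul_nonneg hk h.1
    rw [Real.norm_eq_abs, abs_of_nonneg (by positivity)]
    exact div_le_self hη (by linarith)
  have hlin : Integrable (fun ω => η / (1 + k * m) - η * k / (1 + k * m) ^ 2 * (U ω - m)) P :=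
    (integrable_const _).sub (hUmi.const_mul _)
  have hlin0 : ∫ ω, (η / (1 + k * m) - η * k / (1 + k * m) ^ 2 * (U ω - m)) ∂P =
      η / (1 + k * m) := by
    rw [integral_sub (integrable_const _) (hUmi.const_mul _), integral_const_mul,
      integral_sub hUi (integrable_const m), ← hm]
    simp
  have hvar : ∫ ω, (U ω - m) ^ 2 ∂P = variance U P := (variance_eq_integral hU.aemeasurable).symm
  -- The remainder is nonnegative, and `1 + k U ≥ 1` bounds it by a multiple of `(U - m)²`; the
  -- linear term integrates to zero.
  have hcmp : ∀ᵐ ω ∂P, η / (1 + k * m) - η * k / (1 + k * m) ^ 2 * (U ω - m) ≤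
      η / (1 + k * U ω) ∧ η / (1 + k * U ω) ≤
      (η / (1 + k * m) - η * k / (1 + k * m) ^ 2 * (U ω - m)) +
        η * k ^ 2 / (1 + k * m) ^ 2 * (U ω - m) ^ 2 := by
    filter_upwards [hU01] with ω h
    have h0 : 0 ≤ k * U ω := mul_nonneg hk h.1
    have h1 : 0 < 1 + k * U ω := by linarith
    rw [div_one_add_mul_eq h1.ne' hmk.ne']
    constructor
    · have : 0 ≤ η * k ^ 2 * (U ω - m) ^ 2 / ((1 + k * U ω) * (1 + k * m) ^ 2) := by positivity
      linarith
    · have : η * k ^ 2 * (U ω - m) ^ 2 / ((1 + k * U ω) * (1 + k * m) ^ 2) ≤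
          η * k ^ 2 / (1 + k * m) ^ 2 * (U ω - m) ^ 2 := by
        rw [div_mul_eq_mul_div]
        refine div_le_div_of_nonneg_left (by positivity) (by positivity) ?_
        nlinarith [sq_nonneg (1 + k * m)]
      linarith
  have hlow := integral_mono_ae hlin hfi (hcmp.mono fun ω h => h.1)
  have hup := integral_mono_ae hfi (hlin.add (hsqi.const_mul _)) (hcmp.mono fun ω h => h.2)
  simp only [Pi.add_apply] at hup
  rw [integral_add hlin (hsqi.const_mul _), integral_const_mul, hvar, hlin0] at hup
  rw [hlin0] at hlow
  refine ⟨by linarith, ?_⟩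
  rw [mul_div_right_comm]
  linarith

theorem exp_neg_sub_exp_neg_le {a b : ℝ} (ha : 0 ≤ a) (hab : a ≤ b) :
    Real.exp (-a) - Real.exp (-b) ≤ b - a := by
  have h1 : Real.exp (-b) = Real.exp (-a) * Real.exp (-(b - a)) := by
    rw [← Real.exp_add]; congr 1; ring
  have h2 := Real.add_one_le_exp (-(b - a))
  have h3 : Real.exp (-a) ≤ 1 := Real.exp_le_one_iff.2 (by linarith)
  rw [h1]
  nlinarith [Real.exp_pos (-a)]

theorem TSAParams.load_nonneg {p : TSAParams} (hlam : 0 < p.lam) (hα : 2 < p.α) (hθ : 0 < p.θ) :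
    0 ≤ p.load := by
  have := TSAParams.Omega_nonneg hα
  rw [TSAParams.load]
  positivity

theorem mainTheorem3 {Ω : Type*} [MeasurableSpace Ω] (P : Measure Ω) [IsProbabilityMeasure P]
    (p : TSAParams) (hlam : 0 < p.lam) (hr : 0 < p.r) (hα : 2 < p.α) (hθ : 0 < p.θ)
    (hη : 0 < p.η) (hη' : p.η ≤ 1) :
    -- the interference-limited network: no noise
    (∀ N : TSANetwork Ω, N.IsMeanField p P ⊤ →
      (∀ᵐ ω ∂P, Tendsto (fun T => N.activeAverage p P ⊤ T ω) atTop
        (𝓝 (N.activeFraction p P ⊤ ω))) ∧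
      N.activeProb p P ⊤ = ∫ u in Set.Icc (0 : ℝ) 1, p.η / (1 + p.A * p.η * u)
        ∂(N.rateLaw p P ⊤) ∧
      ∀ t : ℕ,
        N.successProb p P ⊤ t = Real.exp (-(p.load * N.activeProb p P ⊤)) ∧
        N.successProb p P ⊤ t ≤
          Real.exp (-(p.load * p.η / (1 + p.A * p.η * N.successProb p P ⊤ t))) ∧
        Real.exp (-(p.load * p.η / (1 + p.A * p.η * N.successProb p P ⊤ t))) -
            N.successProb p P ⊤ t ≤
          p.load * p.A ^ 2 * p.η ^ 3 * variance (N.serviceRate p P ⊤) P /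
            (1 + p.A * p.η * N.successProb p P ⊤ t) ^ 2) ∧
    -- the limit of vanishing noise
    (∀ ε : ℝ, 0 < ε → ∀ᶠ ρ in 𝓝 (⊤ : ℝ≥0∞), ∀ N : TSANetwork Ω, N.IsMeanField p P ρ →
      (∀ᵐ ω ∂P, Tendsto (fun T => N.activeAverage p P ρ T ω) atTop
        (𝓝 (N.activeFraction p P ρ ω))) ∧
      N.activeProb p P ρ = ∫ u in Set.Icc (0 : ℝ) 1, p.η / (1 + p.A * p.η * u)
        ∂(N.rateLaw p P ρ) ∧
      ∀ t : ℕ, |N.successProb p P ρ t - Real.exp (-(p.load * N.activeProb p P ρ))| < ε) := by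
  have hload := TSAParams.load_nonneg hlam hα hθ
  have hconv : ∀ (ρ : ℝ≥0∞) (N : TSANetwork Ω), N.IsMeanField p P ρ →
      ∀ᵐ ω ∂P, Tendsto (fun T => N.activeAverage p P ρ T ω) atTop
        (𝓝 (N.activeFraction p P ρ ω)) := by
    intro ρ N h
    filter_upwards [h.ae_tendsto_activeAverage hη.le hη', h.activeFraction_ae_eq hη.le hη']
      with ω h1 h2
    rw [h2]
    exact h1
  refine ⟨fun N h => ⟨hconv ⊤ N h, h.activeProb_eq_rateLaw hη.le hη', fun t => ?_⟩, ?_⟩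
  · have hs : ∀ t, N.successProb p P ⊤ t = Real.exp (-(p.load * N.activeProb p P ⊤)) := by
      intro t
      rw [h.successProb_eq hlam hr hα hθ hη.le hη' t]
      simp [expNeg_zero]
    -- The service rate is defined through slot 0; its mean serves every slot because the closed
    -- form does not involve `t`.
    have hmean : ∫ ω, N.serviceRate p P ⊤ ω ∂P = N.successProb p P ⊤ t := (hs 0).trans (hs t).symm
    have hJ := integral_div_one_add_mul_sub_mem_Icc h.measurable_serviceRate h.serviceRate_mem_Icc
      hη.le (k := p.A * p.η) (by positivity)
    rw [← h.activeProb_eq hη.le hη', hmean] at hJ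
    have hS : 0 ≤ N.successProb p P ⊤ t := by rw [hs]; positivity
    have hle : p.load * p.η / (1 + p.A * p.η * N.successProb p P ⊤ t) ≤
        p.load * N.activeProb p P ⊤ := by
      rw [mul_div_assoc]
      exact mul_le_mul_of_nonneg_left (by linarith [hJ.1]) hload
    refine ⟨hs t, ?_, ?_⟩
    · conv_lhs => rw [hs t]
      exact Real.exp_le_exp.2 (neg_le_neg hle)
    · have h1 := exp_neg_sub_exp_neg_le (by positivity) hle
      rw [← hs t] at h1
      refine h1.trans ?_
      have h2 := mul_le_mul_of_nonneg_left hJ.2 hload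
      calc p.load * N.activeProb p P ⊤ - p.load * p.η / (1 + p.A * p.η * N.successProb p P ⊤ t)
          = p.load * (N.activeProb p P ⊤ - p.η / (1 + p.A * p.η * N.successProb p P ⊤ t)) := by
            ring
        _ ≤ _ := h2
        _ = _ := by ring
  · intro ε hε
    -- The noise factor involves neither network nor slot, so one neighbourhood of `⊤` serves them
    -- all; the other factor is at most 1.
    have hcont : Tendsto (fun ρ : ℝ≥0∞ => (expNeg (ENNReal.ofReal (p.θ * p.r ^ p.α) * ρ⁻¹)).toReal)
        (𝓝 ⊤) (𝓝 1) := by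
      have h1 : Tendsto (fun ρ : ℝ≥0∞ => ENNReal.ofReal (p.θ * p.r ^ p.α) * ρ⁻¹) (𝓝 ⊤) (𝓝 0) := by
        have := ENNReal.Tendsto.const_mul (a := ENNReal.ofReal (p.θ * p.r ^ p.α))
          (continuous_inv.tendsto (⊤ : ℝ≥0∞)) (Or.inr ENNReal.ofReal_ne_top)
        simpa using this
      have h2 := (continuous_expNeg.tendsto 0).comp h1
      rw [expNeg_zero] at h2
      exact (ENNReal.tendsto_toReal ENNReal.one_ne_top).comp h2
    filter_upwards [Metric.tendsto_nhds.1 hcont ε hε] with ρ hρ N h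
    refine ⟨hconv ρ N h, h.activeProb_eq_rateLaw hη.le hη', fun t => ?_⟩
    rw [Real.dist_eq] at hρ
    rw [h.successProb_eq hlam hr hα hθ hη.le hη' t, ← sub_one_mul, abs_mul, Real.abs_exp]
    refine (mul_le_of_le_one_right (abs_nonneg _) ?_).trans_lt hρ
    exact Real.exp_le_one_iff.2 (neg_nonpos.2
      (mul_nonneg hload (h.activeProb_mem_Icc hη.le hη').1))
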